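/- Let $f$ be a smooth real-valued function on an open subset $U\subseteq\mathbb{R}^3$. For a flat Riemannian metric $g_{ij}$ with metric connection $\nabla_i$ write $f_i=\nabla_if$, $f_{ij}=\nabla_i\nabla_jf$, $f_{ijk}=\nabla_i\nabla_j\nabla_kf$, and so on; indices are raised and lowered with $g_{ij}$, repeated indices are contracted, and round brackets denote symmetrisation (with the factor $1/k!$). A *conformal differential invariant of weight $w$* is a polynomial $I=I(g^{ij},f,f_i,f_{ij},f_{ijk},\ldots)$ with real coefficients such that (a) $I$ is invariant under arbitrary smooth coordinate transformations, and (b) whenever $g_{ij}$ is the Euclidean metric on $U$ and $\Omega$ is a smooth non-vanishing function on $U$ for which $\hat g_{ij}=\Omega^2g_{ij}$ is also flat, with metric connection $\hat\nabla_i$, $$I(\hat g^{ij},f,\hat\nabla_if,\hat\nabla_i\hat\nabla_jf,\ldots)=\Omega^w\,I(g^{ij},f,\nabla_if,\nabla_i\nabla_jf,\ldots).$$ Define $$J=f^if_i,\qquad Z=f^{ij}f_if_j+Jf^j{}_j,\qquad X=2f_i{}^jf_jf^{ik}f_k-Jf^{jk}f_{jk}+J(f^j{}_j)^2,$$ $$\sigma_i=J\nabla_iZ-2Z\nabla_iJ,\qquad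 \tau_i=J\nabla_iX-3X\nabla_iJ,$$ $$\phi_{ij}=Jf_{ij}-2f_{(i}f_{j)}{}^kf_k-\tfrac13Jf^k{}_kg_{ij}+\tfrac23f^{kl}f_kf_lg_{ij},$$ $$\rho_{ijk}=J\nabla_{(i}\phi_{jk)}-3\phi_{(ij}\nabla_{k)}J-\tfrac25Jg_{(ij}\nabla^l\phi_{k)l}+\tfrac65g_{(ij}\phi_{k)l}\nabla^lJ,$$ $$\lambda_j=2J\nabla^i\phi_{ij}-\phi_{ij}\nabla^iJ,$$ and $$R=f^i\sigma_i,\quad S=f^i\tau_i,\quad A=\sigma^i\sigma_i,\quad B=\tau^i\tau_i,\quad D=\sigma^i\tau_i,\quad T=\phi^{ij}\sigma_i\sigma_j,\quad U=\phi^{ij}\tau_i\tau_j,$$ $$F=\rho^{ijk}\phi_{ij}\lambda_k,\quad G=\phi^{ij}\lambda_i\lambda_j,\quad K=\sigma^i\lambda_i,\quad M=\tau^i\lambda_i,\quad N=\sigma_i\rho^{ijk}\phi_{jk},\quad W=\rho^{ijk}\rho_{ij}{}^l\phi_{kl}.$$ **Theorem.** Each of these sixteen scalars is (given by) a conformal differential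 invariant of $f$, with the following weights: $$\begin{array}{c|cccccccccccccccc} &J&Z&X&R&S&A&B&D&T&U&F&G&K&M&N&W\\\hline w&-2&-4&-6&-8&-10&-14&-18&-16&-18&-22&-18&-18&-14&-16&-18&-18 \end{array}$$ -/

import Mathlib

open scoped ContDiff

noncomputable section

namespace ConfInv

/-! ### Tensor calculus in coordinates on open subsets of three-space -/

/-- Coordinate three-space. The metrics below are explicit tensors, so only the smooth structure of
this space matters, not its norm. -/
abbrev Pt : Type := Fin 3 → ℝ

/-- Covariant tensor fields of rank `k`, through their components `T x ![i₁, …, i_k]`. -/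
abbrev Tensor (k : ℕ) : Type := Pt → (Fin k → Fin 3) → ℝ

/-- Metric components `g_{ij}` as functions of the point. -/
abbrev MetricField : Type := Pt → Matrix (Fin 3) (Fin 3) ℝ

/-- The partial derivative `∂u/∂x^i`. -/
def pd (i : Fin 3) (u : Pt → ℝ) (x : Pt) : ℝ := fderiv ℝ u x (Pi.single i 1)

/-- The inverse metric `g^{ij}`. -/
def ginv (G : MetricField) (x : Pt) (i j : Fin 3) : ℝ := (G x)⁻¹ i j

/-- The Christoffel symbols `Γ^l_{ij}` of the metric (Levi-Civita) connection. -/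
def christoffel (G : MetricField) (l i j : Fin 3) (x : Pt) : ℝ :=
  (1 / 2 : ℝ) * ∑ m, ginv G x l m *
    (pd i (fun y => G y j m) x + pd j (fun y => G y i m) x - pd m (fun y => G y i j) x)

/-- The Riemann curvature `R^l_{kij}`. -/
def riemann (G : MetricField) (l k i j : Fin 3) (x : Pt) : ℝ :=
  pd i (christoffel G l j k) x - pd j (christoffel G l i k) x
    + ∑ m, (christoffel G l i m x * christoffel G m j k x
        - christoffel G l j m x * christoffel G m i k x)

/-- `G` is a smooth flat Riemannian metric on `U`. -/
structure IsFlatMetricOn (G : MetricField) (U : Set Pt) : Prop where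
  smooth : ∀ i j, ContDiffOn ℝ ∞ (fun x => G x i j) U
  posDef : ∀ x ∈ U, (G x).PosDef
  flat : ∀ x ∈ U, ∀ l k i j, riemann G l k i j x = 0

/-- The metric connection on covariant tensors; the new index comes first:
`(∇T)_{i a₁ … a_k} = ∂_i T_{a₁ … a_k} - ∑_p Γ^m_{i a_p} T_{a₁ … m … a_k}`, with `m` in the
`p`-th place. -/
def nabla (G : MetricField) {k : ℕ} (T : Tensor k) : Tensor (k + 1) := fun x a =>
  pd (a 0) (fun y => T y (Fin.tail a)) x
    - ∑ p : Fin k, ∑ m, christoffel G m (a 0) (Fin.tail a p) x *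
        T x (Function.update (Fin.tail a) p m)

/-- The iterated covariant derivatives `f_{i₁ … i_k} = ∇_{i₁} ⋯ ∇_{i_k} f`. -/
def covD (G : MetricField) (f : Pt → ℝ) : (k : ℕ) → Tensor k
  | 0 => fun x _ => f x
  | k + 1 => nabla G (covD G f k)

/-- Raising all indices: `T^{i₁ … i_k} = g^{i₁ j₁} ⋯ g^{i_k j_k} T_{j₁ … j_k}`. -/
def up (G : MetricField) {k : ℕ} (T : Tensor k) : Tensor k := fun x i =>
  ∑ j : Fin k → Fin 3, (∏ p, ginv G x (i p) (j p)) * T x j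

/-- Symmetrisation over all indices, `T_{(i₁ … i_k)}`. -/
def sym {k : ℕ} (T : Tensor k) : Tensor k := fun x i =>
  (1 / (k.factorial : ℝ)) * ∑ s : Equiv.Perm (Fin k), T x (i ∘ s)

/-- The one-form `∇_i u` of a scalar `u`. -/
def grad (u : Pt → ℝ) : Tensor 1 := fun x a => pd (a 0) u x

/-! ### Conformal differential invariants -/

/-- The indeterminates: inverse metric components `g^{ij}`, and derivatives `f_{i₁ … i_k}` of all
orders `k ≥ 0`. -/
inductive JetVar : Type
  | metric (i j : Fin 3) : JetVar
  | deriv (k : ℕ) (a : Fin k → Fin 3) : JetVar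

/-- The value at `x` of the indeterminates, for the metric `G` and the function `f`. -/
def jet (G : MetricField) (f : Pt → ℝ) (x : Pt) : JetVar → ℝ
  | .metric i j => ginv G x i j
  | .deriv k a => covD G f k x a

/-- `I(g^{ij}, f, f_i, f_{ij}, …)` at the point `x`. -/
def evalJet (P : MvPolynomial JetVar ℝ) (G : MetricField) (f : Pt → ℝ) (x : Pt) : ℝ :=
  MvPolynomial.eval (jet G f x) P

/-- The Jacobian matrix `∂Φ^a/∂x^i`, with row `a` and column `i`. -/
def jacobian (Φ : Pt → Pt) (x : Pt) : Matrix (Fin 3) (Fin 3) ℝ :=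
  fun a i => pd i (fun y => Φ y a) x

/-- The metric `G` in the coordinates `x`, where the old coordinates are `Φ x`. -/
def pullback (Φ : Pt → Pt) (G : MetricField) : MetricField := fun x i j =>
  ∑ a, ∑ b, jacobian Φ x a i * jacobian Φ x b j * G (Φ x) a b

/-- Invariance under arbitrary coordinate transformations. -/
def CoordinateInvariant (P : MvPolynomial JetVar ℝ) : Prop :=
  ∀ (U V : Set Pt) (G : MetricField) (f : Pt → ℝ) (Φ : Pt → Pt),
    IsOpen U → IsOpen V → IsFlatMetricOn G U → ContDiffOn ℝ ∞ f U →
    ContDiffOn ℝ ∞ Φ V → Set.MapsTo Φ V U → (∀ x ∈ V, (jacobian Φ x).det ≠ 0) →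
    ∀ x ∈ V, evalJet P (pullback Φ G) (f ∘ Φ) x = evalJet P G f (Φ x)

/-- The Euclidean metric in standard coordinates. -/
def euclid : MetricField := fun _ => 1

/-- The rescaled metric `Ω² g`. -/
def rescale (Ω : Pt → ℝ) (G : MetricField) : MetricField := fun x => (Ω x) ^ 2 • G x

/-- Covariance with weight `w` under all flat-to-flat conformal rescalings: the value of `P`
computed with the metric `Ω² g` and its metric connection is `Ω^w` times the one computed with
`g`. -/
def ConformallyCovariant (P : MvPolynomial JetVar ℝ) (w : ℤ) : Prop :=
  ∀ (U : Set Pt) (f Ω : Pt → ℝ), IsOpen U → ContDiffOn ℝ ∞ f U → ContDiffOn ℝ ∞ Ω U →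
    (∀ x ∈ U, Ω x ≠ 0) → IsFlatMetricOn (rescale Ω euclid) U →
    ∀ x ∈ U, evalJet P (rescale Ω euclid) f x = (Ω x) ^ w * evalJet P euclid f x

/-- A quantity `I`, formed from a metric and a function by any means, is a conformal differential
invariant of weight `w` if it is given by one polynomial in the inverse metric and the covariant
derivatives of `f` that is invariant under coordinate transformations and is conformally covariant
of weight `w`. -/
def IsConformalInvariant (I : MetricField → (Pt → ℝ) → Pt → ℝ) (w : ℤ) : Prop :=
  ∃ P : MvPolynomial JetVar ℝ,
    (∀ (U : Set Pt) (G : MetricField) (f : Pt → ℝ), IsOpen U → IsFlatMetricOn G U →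
      ContDiffOn ℝ ∞ f U → ∀ x ∈ U, I G f x = evalJet P G f x) ∧
    CoordinateInvariant P ∧ ConformallyCovariant P w

/-! ### The quantities -/

section Quantities

variable (G : MetricField) (f : Pt → ℝ)

/-- `f^i_i`. -/
def lap (x : Pt) : ℝ := ∑ i, ∑ j, ginv G x i j * covD G f 2 x ![i, j]

/-- `f_i^k f_k`. -/
def hessGrad (x : Pt) (i : Fin 3) : ℝ := ∑ k, covD G f 2 x ![i, k] * up G (covD G f 1) x ![k]

/-- `f^{kl} f_k f_l`. -/
def hessGradGrad (x : Pt) : ℝ :=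
  ∑ k, ∑ l, up G (covD G f 2) x ![k, l] * covD G f 1 x ![k] * covD G f 1 x ![l]

/-- `J = f^i f_i`. -/
def J (x : Pt) : ℝ := ∑ i, up G (covD G f 1) x ![i] * covD G f 1 x ![i]

/-- `Z = f^{ij} f_i f_j + J f^j_j`. -/
def Z (x : Pt) : ℝ := hessGradGrad G f x + J G f x * lap G f x

/-- `X = 2 f_i^j f_j f^{ik} f_k - J f^{jk} f_{jk} + J (f^j_j)²`. -/
def X (x : Pt) : ℝ :=
  2 * ∑ i, ∑ k, hessGrad G f x i * up G (covD G f 2) x ![i, k] * covD G f 1 x ![k]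
    - J G f x * ∑ j, ∑ k, up G (covD G f 2) x ![j, k] * covD G f 2 x ![j, k]
    + J G f x * (lap G f x) ^ 2

/-- `σ_i = J ∇_i Z - 2 Z ∇_i J`. -/
def sigma : Tensor 1 := fun x a =>
  J G f x * grad (Z G f) x a - 2 * Z G f x * grad (J G f) x a

/-- `τ_i = J ∇_i X - 3 X ∇_i J`. -/
def tau : Tensor 1 := fun x a =>
  J G f x * grad (X G f) x a - 3 * X G f x * grad (J G f) x a

/-- `φ_{ij} = J f_{ij} - 2 f_{(i} f_{j)}^k f_k - ⅓ J f^k_k g_{ij} + ⅔ f^{kl} f_k f_l g_{ij}`. -/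
def phi : Tensor 2 := fun x a =>
  J G f x * covD G f 2 x a
    - 2 * sym (fun y (b : Fin 2 → Fin 3) => covD G f 1 y ![b 0] * hessGrad G f y (b 1)) x a
    - (1 / 3) * J G f x * lap G f x * G x (a 0) (a 1)
    + (2 / 3) * hessGradGrad G f x * G x (a 0) (a 1)

/-- `∇^l φ_{kl}` (equal to `∇^l φ_{lk}`, as `φ` is symmetric). -/
def divPhi (x : Pt) (k : Fin 3) : ℝ :=
  ∑ l, ∑ m, ginv G x l m * nabla G (phi G f) x ![l, k, m]

/-- `φ_{kl} ∇^l J`. -/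
def phiGradJ (x : Pt) (k : Fin 3) : ℝ :=
  ∑ l, phi G f x ![k, l] * up G (grad (J G f)) x ![l]

/-- `ρ_{ijk} = J ∇_{(i} φ_{jk)} - 3 φ_{(ij} ∇_{k)} J - ⅖ J g_{(ij} ∇^l φ_{k)l}
+ (6/5) g_{(ij} φ_{k)l} ∇^l J`. -/
def rho : Tensor 3 := sym fun x a =>
  J G f x * nabla G (phi G f) x a
    - 3 * phi G f x ![a 0, a 1] * grad (J G f) x ![a 2]
    - (2 / 5) * J G f x * G x (a 0) (a 1) * divPhi G f x (a 2)
    + (6 / 5) * G x (a 0) (a 1) * phiGradJ G f x (a 2)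

/-- `λ_j = 2 J ∇^i φ_{ij} - φ_{ij} ∇^i J`. -/
def lam : Tensor 1 := fun x a =>
  2 * J G f x * divPhi G f x (a 0) - phiGradJ G f x (a 0)

/-- `S^i T_i` for one-forms. -/
def pair (S T : Tensor 1) (x : Pt) : ℝ := ∑ i, up G S x ![i] * T x ![i]

/-- `φ^{ij} S_i T_j` for one-forms. -/
def phiPair (S T : Tensor 1) (x : Pt) : ℝ :=
  ∑ i, ∑ j, up G (phi G f) x ![i, j] * S x ![i] * T x ![j]

/-- `R = f^i σ_i`. -/
def R (x : Pt) : ℝ := pair G (covD G f 1) (sigma G f) x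

/-- `S = f^i τ_i`. -/
def S (x : Pt) : ℝ := pair G (covD G f 1) (tau G f) x

/-- `A = σ^i σ_i`. -/
def A (x : Pt) : ℝ := pair G (sigma G f) (sigma G f) x

/-- `B = τ^i τ_i`. -/
def B (x : Pt) : ℝ := pair G (tau G f) (tau G f) x

/-- `D = σ^i τ_i`. -/
def D (x : Pt) : ℝ := pair G (sigma G f) (tau G f) x

/-- `T = φ^{ij} σ_i σ_j`. -/
def T (x : Pt) : ℝ := phiPair G f (sigma G f) (sigma G f) x

/-- `U = φ^{ij} τ_i τ_j`. -/
def U (x : Pt) : ℝ := phiPair G f (tau G f) (tau G f) x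

/-- `F = ρ^{ijk} φ_{ij} λ_k`. -/
def F (x : Pt) : ℝ :=
  ∑ i, ∑ j, ∑ k, up G (rho G f) x ![i, j, k] * phi G f x ![i, j] * lam G f x ![k]

/-- `G = φ^{ij} λ_i λ_j`; here `G` without index is the metric. -/
def GG (x : Pt) : ℝ := phiPair G f (lam G f) (lam G f) x

/-- `K = σ^i λ_i`. -/
def K (x : Pt) : ℝ := pair G (sigma G f) (lam G f) x

/-- `M = τ^i λ_i`. -/
def M (x : Pt) : ℝ := pair G (tau G f) (lam G f) x

/-- `N = σ_i ρ^{ijk} φ_{jk}`. -/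
def N (x : Pt) : ℝ :=
  ∑ i, ∑ j, ∑ k, sigma G f x ![i] * up G (rho G f) x ![i, j, k] * phi G f x ![j, k]

/-- `W = ρ^{ijk} ρ_{ij}^l φ_{kl}`. -/
def W (x : Pt) : ℝ :=
  ∑ i, ∑ j, ∑ k, ∑ l, up G (rho G f) x ![i, j, k] *
    (∑ m, rho G f x ![i, j, m] * ginv G x m l) * phi G f x ![k, l]

end Quantities

end ConfInv

end

noncomputable section

namespace ConfInv

/-! ### Partial derivatives -/

section PartialDerivatives

variable {U : Set Pt} {u v : Pt → ℝ} {x : Pt}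

/-! Each scalar needs three facts: it is a polynomial in the jet variables, it is unchanged by
coordinate changes, and it is multiplied by a power of Ω under rescaling. `isConformalInvariant`
assembles them.

Coordinate invariance rests on the law A Γ' = ∂A + Γ A A for the Jacobian A
(`IsCoordChange.christoffel_pullback`). It makes covariant derivatives of tensors tensorial
(`IsNatural₁.cov`, `IsNatural₂.cov`), while contraction with the inverse metric absorbs Jacobian
factors (`contract_tensor`).

Polynomiality meets two obstacles. First, gradients such as ∇Z are partial derivatives of
contractions; since ∇g⁻¹ = 0 they equal contractions of covariant derivatives (`pd_sum_ginv_mul`),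
so no Christoffel symbol survives. The structures `IsTensor₀`, `IsTensor₁`, `IsTensor₂` carry this
through the algebra. Second, φ and ρ contain lowered components g_{ij}, which are not polynomial in
g^{ij}. Both are split into a metric-free part and multiples of g (`phi₂_eq`, `rho_eq`); in a full
contraction every such g meets raised indices and turns into δ or g^{ij}.

For the weights put υ_i = ∂_iΩ/Ω. Then Γ̂^l_{ij} = δ^l_i υ_j + δ^l_j υ_i - δ_{ij} υ_l, so f_{ij}
changes by -υ_i f_j - υ_j f_i + δ_{ij} υ·f. In Z, X and φ the terms in υ cancel, leaving the factors
Ω⁻⁴, Ω⁻⁶, Ω⁻². The third-order objects differentiate these only once, so derivatives of υ never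
enter. Where J ≠ 0, σ = J³∇(Z/J²) and τ = J⁴∇(X/J³) are gradients of weightless functions up to
powers of J. As φ is symmetric and trace-free, the coefficients in λ and ρ are those cancelling υ in
its divergence and in its trace-free symmetrised derivative (`lam_rescale`, `rho_rescale`). The
scalars are contractions of these objects: weights add, and each inverse metric contributes -2. -/

theorem differentiableAt_of_contDiffOn (hU : IsOpen U) (hu : ContDiffOn ℝ ∞ u U) (hx : x ∈ U) :
    DifferentiableAt ℝ u x :=
  (hu.contDiffAt (hU.mem_nhds hx)).differentiableAt (by simp)

theorem pd_congr (hU : IsOpen U) (h : ∀ y ∈ U, u y = v y) (hx : x ∈ U) (i : Fin 3) :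
    pd i u x = pd i v x := by
  have : u =ᶠ[nhds x] v := Filter.eventuallyEq_of_mem (hU.mem_nhds hx) h
  simp only [pd, this.fderiv_eq]

theorem pd_const (c : ℝ) (i : Fin 3) : pd i (fun _ => c) x = 0 := by
  simp [pd]

theorem pd_add (hu : DifferentiableAt ℝ u x) (hv : DifferentiableAt ℝ v x) (i : Fin 3) :
    pd i (fun y => u y + v y) x = pd i u x + pd i v x := by
  simp [pd, fderiv_fun_add hu hv]

theorem pd_mul (hu : DifferentiableAt ℝ u x) (hv : DifferentiableAt ℝ v x) (i : Fin 3) :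
    pd i (fun y => u y * v y) x = pd i u x * v x + u x * pd i v x := by
  simp [pd, fderiv_fun_mul hu hv]; ring

theorem pd_sum {ι : Type*} {s : Finset ι} {w : ι → Pt → ℝ}
    (hw : ∀ a ∈ s, DifferentiableAt ℝ (w a) x) (i : Fin 3) :
    pd i (fun y => ∑ a ∈ s, w a y) x = ∑ a ∈ s, pd i (w a) x := by
  simp [pd, fderiv_fun_sum hw]

theorem contDiffOn_pd (hU : IsOpen U) (hu : ContDiffOn ℝ ∞ u U) (i : Fin 3) :
    ContDiffOn ℝ ∞ (pd i u) U :=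
  (hu.fderiv_of_isOpen hU (m := ∞) (by simp)).clm_apply contDiffOn_const

theorem pd_comm (hU : IsOpen U) (hu : ContDiffOn ℝ ∞ u U) (hx : x ∈ U) (i j : Fin 3) :
    pd i (pd j u) x = pd j (pd i u) x := by
  have hd : DifferentiableAt ℝ (fderiv ℝ u) x :=
    ((hu.fderiv_of_isOpen hU (m := ∞) (by simp)).contDiffAt (hU.mem_nhds hx)).differentiableAt
      (by simp)
  have key : ∀ i j, pd i (pd j u) x
      = fderiv ℝ (fderiv ℝ u) x (Pi.single i 1) (Pi.single j 1) := by
    intro i j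
    change fderiv ℝ (fun y => fderiv ℝ u y (Pi.single j 1)) x (Pi.single i 1) = _
    rw [fderiv_clm_apply hd (differentiableAt_const _)]
    simp
  rw [key, key]
  exact ((hu.contDiffAt (hU.mem_nhds hx)).isSymmSndFDerivAt
    (by simpa using (WithTop.coe_le_coe.2 le_top : ((2 : ℕ∞) : WithTop ℕ∞) ≤ ((⊤ : ℕ∞))))).eq _ _

theorem pd_comp {Φ : Pt → Pt} (hu : DifferentiableAt ℝ u (Φ x)) (hΦ : DifferentiableAt ℝ Φ x)
    (c : Fin 3) :
    pd c (fun y => u (Φ y)) x = ∑ a, jacobian Φ x a c * pd a u (Φ x) := by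
  have h1 : fderiv ℝ (fun y => u (Φ y)) x = (fderiv ℝ u (Φ x)).comp (fderiv ℝ Φ x) :=
    fderiv_comp x hu hΦ
  have h2 : ∀ a, jacobian Φ x a c = fderiv ℝ Φ x (Pi.single c 1) a := by
    intro a
    simp [jacobian, pd, fderiv_apply hΦ]
  simp only [pd, h1, ContinuousLinearMap.comp_apply, h2]
  generalize fderiv ℝ Φ x (Pi.single c 1) = w
  conv_lhs => rw [pi_eq_sum_univ' w]
  simp

end PartialDerivatives

/-! ### Smooth metrics -/

/-- A smooth Riemannian metric and a smooth function on an open set. -/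
structure IsMetricPair (G : MetricField) (f : Pt → ℝ) (U : Set Pt) : Prop where
  isOpen : IsOpen U
  smooth : ∀ i j, ContDiffOn ℝ ∞ (fun x => G x i j) U
  posDef : ∀ x ∈ U, (G x).PosDef
  smooth_fun : ContDiffOn ℝ ∞ f U

theorem IsFlatMetricOn.isMetricPair {G : MetricField} {f : Pt → ℝ} {U : Set Pt}
    (hG : IsFlatMetricOn G U) (hU : IsOpen U) (hf : ContDiffOn ℝ ∞ f U) : IsMetricPair G f U :=
  ⟨hU, hG.smooth, hG.posDef, hf⟩

namespace IsMetricPair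

variable {G : MetricField} {f : Pt → ℝ} {U : Set Pt} {x : Pt}

theorem det_ne_zero (h : IsMetricPair G f U) (hx : x ∈ U) : (G x).det ≠ 0 :=
  (h.posDef x hx).det_pos.ne'

theorem symm (h : IsMetricPair G f U) (hx : x ∈ U) (i j : Fin 3) : G x i j = G x j i := by
  have := (h.posDef x hx).isHermitian.apply i j
  simpa using this.symm

theorem ginv_symm (h : IsMetricPair G f U) (hx : x ∈ U) (i j : Fin 3) :
    ginv G x i j = ginv G x j i := by
  have := (h.posDef x hx).isHermitian.inv.apply i j
  simpa [ginv] using this.symm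

theorem ginv_mul (h : IsMetricPair G f U) (hx : x ∈ U) (i j : Fin 3) :
    ∑ m, ginv G x i m * G x m j = if i = j then 1 else 0 := by
  have := Matrix.nonsing_inv_mul (G x) (Ne.isUnit (h.det_ne_zero hx))
  have := congrFun (congrFun this i) j
  simpa [Matrix.mul_apply, Matrix.one_apply, ginv] using this

theorem mul_ginv (h : IsMetricPair G f U) (hx : x ∈ U) (i j : Fin 3) :
    ∑ m, G x i m * ginv G x m j = if i = j then 1 else 0 := by
  have := Matrix.mul_nonsing_inv (G x) (Ne.isUnit (h.det_ne_zero hx))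
  have := congrFun (congrFun this i) j
  simpa [Matrix.mul_apply, Matrix.one_apply, ginv] using this

/-- By Cramer's rule the entries are cofactors over a nonvanishing determinant. -/
theorem contDiffOn_ginv (h : IsMetricPair G f U) (i j : Fin 3) :
    ContDiffOn ℝ ∞ (fun x => ginv G x i j) U := by
  have hs := h.smooth
  have hdet : ContDiffOn ℝ ∞ (fun x => (G x).det) U := by
    simp only [Matrix.det_fin_three]
    fun_prop
  have hadj : ContDiffOn ℝ ∞ (fun x => (G x).adjugate i j) U := by
    simp only [Matrix.adjugate_fin_three]
    fin_cases i <;> fin_cases j <;> simp <;> fun_prop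
  have : ContDiffOn ℝ ∞ (fun x => ((G x).det)⁻¹ * (G x).adjugate i j) U :=
    (hdet.inv fun x hx => h.det_ne_zero hx).mul hadj
  refine this.congr fun x _ => ?_
  simp [ginv, Matrix.inv_def]

theorem contDiffOn_christoffel (h : IsMetricPair G f U) (l i j : Fin 3) :
    ContDiffOn ℝ ∞ (christoffel G l i j) U := by
  unfold christoffel
  refine contDiffOn_const.mul (ContDiffOn.sum fun m _ => (h.contDiffOn_ginv l m).mul ?_)
  exact ((contDiffOn_pd h.isOpen (h.smooth _ _) _).add
    (contDiffOn_pd h.isOpen (h.smooth _ _) _)).sub (contDiffOn_pd h.isOpen (h.smooth _ _) _)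

/-- These are the Christoffel symbols of the first kind. Being linear in ∂g and free of g⁻¹, they
are the convenient form both for ∇g = 0 and for the transformation law. -/
theorem lower_christoffel (h : IsMetricPair G f U) (hx : x ∈ U) (m i j : Fin 3) :
    ∑ l, G x m l * christoffel G l i j x =
      (1 / 2 : ℝ) * (pd i (fun y => G y j m) x + pd j (fun y => G y i m) x
        - pd m (fun y => G y i j) x) := by
  simp only [christoffel]
  calc _ = (1 / 2 : ℝ) * ∑ k, (∑ l, G x m l * ginv G x l k) * (pd i (fun y => G y j k) x
          + pd j (fun y => G y i k) x - pd k (fun y => G y i j) x) := by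
        simp only [Finset.mul_sum, Finset.sum_mul]
        rw [Finset.sum_comm]
        refine Finset.sum_congr rfl fun k _ => Finset.sum_congr rfl fun l _ => by ring
    _ = _ := by simp [h.mul_ginv hx]

/-- Metric compatibility ∇g = 0: adding two first-kind symbols with i and j exchanged leaves only
∂_c g_{ij}. -/
theorem pd_metric (h : IsMetricPair G f U) (hx : x ∈ U) (c i j : Fin 3) :
    pd c (fun y => G y i j) x =
      ∑ m, christoffel G m c i x * G x m j + ∑ m, christoffel G m c j x * G x i m := by
  have e1 : ∑ m, christoffel G m c i x * G x m j = ∑ m, G x j m * christoffel G m c i x :=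
    Finset.sum_congr rfl fun m _ => by rw [h.symm hx m j, mul_comm]
  have e2 : ∑ m, christoffel G m c j x * G x i m = ∑ m, G x i m * christoffel G m c j x :=
    Finset.sum_congr rfl fun m _ => by rw [mul_comm]
  rw [e1, e2, h.lower_christoffel hx, h.lower_christoffel hx,
    pd_congr h.isOpen (fun y hy => h.symm hy j i) hx c]
  ring

/-- This is ∇g⁻¹ = 0, obtained by differentiating g⁻¹g = 1, contracting with g⁻¹ and inserting ∇g =
0. -/
theorem pd_ginv (h : IsMetricPair G f U) (hx : x ∈ U) (c i j : Fin 3) :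
    pd c (fun y => ginv G y i j) x =
      -∑ m, christoffel G i c m x * ginv G x m j - ∑ m, christoffel G j c m x * ginv G x i m := by
  have dG : ∀ i j, DifferentiableAt ℝ (fun y => G y i j) x := fun i j =>
    differentiableAt_of_contDiffOn h.isOpen (h.smooth i j) hx
  have dP : ∀ i j, DifferentiableAt ℝ (fun y => ginv G y i j) x := fun i j =>
    differentiableAt_of_contDiffOn h.isOpen (h.contDiffOn_ginv i j) hx
  have key : ∀ k, ∑ m, pd c (fun y => ginv G y i m) x * G x m k
      = -∑ m, ginv G x i m * pd c (fun y => G y m k) x := by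
    intro k
    have h0 : pd c (fun y => ∑ m, ginv G y i m * G y m k) x = 0 := by
      rw [pd_congr h.isOpen (fun y hy => h.ginv_mul hy i k) hx c, pd_const]
    rw [pd_sum (w := fun m y => ginv G y i m * G y m k) (fun m _ => (dP i m).mul (dG m k))] at h0
    simp only [fun m => pd_mul (dP i m) (dG m k) c, Finset.sum_add_distrib] at h0
    linarith
  have e : pd c (fun y => ginv G y i j) x
      = ∑ k, (∑ m, pd c (fun y => ginv G y i m) x * G x m k) * ginv G x k j := by
    simp only [Finset.sum_mul]
    rw [Finset.sum_comm]
    simp [mul_assoc, ← Finset.mul_sum, h.mul_ginv hx]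
  rw [e]
  simp only [key, h.pd_metric hx]
  have t1 : ∑ k, (∑ m, ginv G x i m * ∑ l, christoffel G l c m x * G x l k) * ginv G x k j
      = ∑ m, christoffel G j c m x * ginv G x i m := by
    calc _ = ∑ m, ∑ l, ginv G x i m * christoffel G l c m x * ∑ k, G x l k * ginv G x k j := by
          simp only [Finset.mul_sum, Finset.sum_mul]
          rw [Finset.sum_comm]
          refine Finset.sum_congr rfl fun m _ => ?_
          rw [Finset.sum_comm]
          refine Finset.sum_congr rfl fun l _ => Finset.sum_congr rfl fun k _ => by ring
      _ = _ := by simp [h.mul_ginv hx, mul_comm]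
  have t2 : ∑ k, (∑ m, ginv G x i m * ∑ l, christoffel G l c k x * G x m l) * ginv G x k j
      = ∑ k, christoffel G i c k x * ginv G x k j := by
    refine Finset.sum_congr rfl fun k _ => ?_
    congr 1
    calc _ = ∑ l, christoffel G l c k x * ∑ m, ginv G x i m * G x m l := by
          simp only [Finset.mul_sum]
          rw [Finset.sum_comm]
          refine Finset.sum_congr rfl fun l _ => Finset.sum_congr rfl fun m _ => by ring
      _ = _ := by simp [h.ginv_mul hx]
  rw [← t1, ← t2]
  simp only [mul_add, Finset.sum_add_distrib, neg_mul, add_mul, Finset.sum_neg_distrib, neg_add]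
  ring

end IsMetricPair

/-! ### Coordinate changes -/

/-- A smooth, possibly non-injective, change of coordinates for a metric and a function. -/
structure IsCoordChange (U V : Set Pt) (G : MetricField) (f : Pt → ℝ) (Φ : Pt → Pt) : Prop where
  pair : IsMetricPair G f U
  isOpen : IsOpen V
  smooth : ContDiffOn ℝ ∞ Φ V
  maps : Set.MapsTo Φ V U
  det : ∀ x ∈ V, (jacobian Φ x).det ≠ 0

namespace IsCoordChange

variable {U V : Set Pt} {G : MetricField} {f : Pt → ℝ} {Φ : Pt → Pt} {x : Pt}

theorem contDiffOn_coord (h : IsCoordChange U V G f Φ) (a : Fin 3) :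
    ContDiffOn ℝ ∞ (fun y => Φ y a) V :=
  contDiffOn_pi.1 h.smooth a

theorem contDiffOn_jacobian (h : IsCoordChange U V G f Φ) (a i : Fin 3) :
    ContDiffOn ℝ ∞ (fun y => jacobian Φ y a i) V :=
  contDiffOn_pd h.isOpen (h.contDiffOn_coord a) i

theorem contDiffOn_comp (h : IsCoordChange U V G f Φ) {u : Pt → ℝ} (hu : ContDiffOn ℝ ∞ u U) :
    ContDiffOn ℝ ∞ (fun y => u (Φ y)) V :=
  hu.comp h.smooth h.maps

theorem pd_jacobian_comm (h : IsCoordChange U V G f Φ) (hx : x ∈ V) (c a i : Fin 3) :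
    pd c (fun y => jacobian Φ y a i) x = pd i (fun y => jacobian Φ y a c) x :=
  pd_comm h.isOpen (h.contDiffOn_coord a) hx c i

theorem differentiableAt (h : IsCoordChange U V G f Φ) (hx : x ∈ V) : DifferentiableAt ℝ Φ x :=
  (h.smooth.contDiffAt (h.isOpen.mem_nhds hx)).differentiableAt (by simp)

theorem pd_comp (h : IsCoordChange U V G f Φ) (hx : x ∈ V) {u : Pt → ℝ}
    (hu : ContDiffOn ℝ ∞ u U) (c : Fin 3) :
    pd c (fun y => u (Φ y)) x = ∑ a, jacobian Φ x a c * pd a u (Φ x) :=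
  ConfInv.pd_comp (differentiableAt_of_contDiffOn h.pair.isOpen hu (h.maps hx))
    (h.differentiableAt hx) c

theorem pullback_eq (Φ : Pt → Pt) (G : MetricField) (x : Pt) :
    (pullback Φ G x) = (jacobian Φ x).transpose * G (Φ x) * jacobian Φ x := by
  ext i j
  simp only [pullback, Matrix.mul_apply, Matrix.transpose_apply, Finset.sum_mul]
  rw [Finset.sum_comm]
  exact Finset.sum_congr rfl fun b _ => Finset.sum_congr rfl fun a _ => by ring

theorem isMetricPair (h : IsCoordChange U V G f Φ) :
    IsMetricPair (pullback Φ G) (f ∘ Φ) V where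
  isOpen := h.isOpen
  smooth i j := by
    unfold pullback
    exact ContDiffOn.sum fun a _ => ContDiffOn.sum fun b _ =>
      ((h.contDiffOn_jacobian a i).mul (h.contDiffOn_jacobian b j)).mul
        (h.contDiffOn_comp (h.pair.smooth a b))
  posDef x hx := by
    rw [pullback_eq]
    have := (h.pair.posDef (Φ x) (h.maps hx)).conjTranspose_mul_mul_same
      (B := jacobian Φ x) (Matrix.mulVec_injective_of_isUnit
        ((Matrix.isUnit_iff_isUnit_det _).2 (Ne.isUnit (h.det x hx))))
    rwa [Matrix.conjTranspose_eq_transpose_of_trivial] at this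
  smooth_fun := h.contDiffOn_comp h.pair.smooth_fun

/-- From g' = AᵀgA comes A g'⁻¹ Aᵀ = g⁻¹. In this form A⁻¹ never appears, and it is exactly what
contractions of covariant tensors produce. -/
theorem ginv_pullback (h : IsCoordChange U V G f Φ) (hx : x ∈ V) (a b : Fin 3) :
    ∑ i, ∑ j, jacobian Φ x a i * ginv (pullback Φ G) x i j * jacobian Φ x b j
      = ginv G (Φ x) a b := by
  have hA : IsUnit (jacobian Φ x).det := Ne.isUnit (h.det x hx)
  have e : jacobian Φ x * (pullback Φ G x)⁻¹ * (jacobian Φ x).transpose = (G (Φ x))⁻¹ := by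
    rw [pullback_eq, Matrix.mul_inv_rev, Matrix.mul_inv_rev, ← Matrix.mul_assoc,
      ← Matrix.mul_assoc, Matrix.mul_nonsing_inv _ hA, Matrix.one_mul, Matrix.mul_assoc,
      Matrix.nonsing_inv_mul _ (by rwa [Matrix.det_transpose]), Matrix.mul_one]
  have := congrFun (congrFun e a) b
  simp only [Matrix.mul_apply, Matrix.transpose_apply, Finset.sum_mul] at this
  rw [Finset.sum_comm] at this
  exact this

theorem pd_pullback (h : IsCoordChange U V G f Φ) (hx : x ∈ V) (c i j : Fin 3) :
    pd c (fun y => pullback Φ G y i j) x = ∑ a, ∑ b,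
      (pd c (fun y => jacobian Φ y a i) x * jacobian Φ x b j * G (Φ x) a b
        + jacobian Φ x a i * pd c (fun y => jacobian Φ y b j) x * G (Φ x) a b
        + jacobian Φ x a i * jacobian Φ x b j *
          ∑ d, jacobian Φ x d c * pd d (fun y => G y a b) (Φ x)) := by
  have dA : ∀ a i, DifferentiableAt ℝ (fun y => jacobian Φ y a i) x := fun a i =>
    differentiableAt_of_contDiffOn h.isOpen (h.contDiffOn_jacobian a i) hx
  have dG : ∀ a b, DifferentiableAt ℝ (fun y => G (Φ y) a b) x := fun a b =>
    differentiableAt_of_contDiffOn h.isOpen (h.contDiffOn_comp (h.pair.smooth a b)) hx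
  have d2 : ∀ a b, DifferentiableAt ℝ (fun y => jacobian Φ y a i * jacobian Φ y b j) x :=
    fun a b => (dA a i).mul (dA b j)
  have d3 : ∀ a b, DifferentiableAt ℝ
      (fun y => jacobian Φ y a i * jacobian Φ y b j * G (Φ y) a b) x :=
    fun a b => (d2 a b).mul (dG a b)
  unfold pullback
  rw [pd_sum (w := fun a y => ∑ b, jacobian Φ y a i * jacobian Φ y b j * G (Φ y) a b)
    (fun a _ => DifferentiableAt.fun_sum fun b _ => d3 a b)]
  refine Finset.sum_congr rfl fun a _ => ?_
  rw [pd_sum (w := fun b y => jacobian Φ y a i * jacobian Φ y b j * G (Φ y) a b)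
    (fun b _ => d3 a b)]
  refine Finset.sum_congr rfl fun b _ => ?_
  rw [pd_mul (d2 a b) (dG a b), pd_mul (dA a i) (dA b j), h.pd_comp hx (h.pair.smooth a b)]
  ring

/-- Differentiating AᵀgA three times over yields six terms with ∂A. By symmetry of the second
derivatives of Φ, four cancel in pairs and the remaining two coincide, which removes the factor 1/2.
-/
theorem lower_christoffel_pullback (h : IsCoordChange U V G f Φ) (hx : x ∈ V) (c i j : Fin 3) :
    ∑ m, pullback Φ G x j m * christoffel (pullback Φ G) m c i x =
      ∑ b, ∑ a, jacobian Φ x b j * G (Φ x) b a * (pd c (fun y => jacobian Φ y a i) x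
        + ∑ d, ∑ e, christoffel G a d e (Φ x) * jacobian Φ x d c * jacobian Φ x e i) := by
  have hy := h.maps hx
  rw [h.isMetricPair.lower_christoffel hx, h.pd_pullback hx, h.pd_pullback hx, h.pd_pullback hx]
  have hR : ∑ b, ∑ a, jacobian Φ x b j * G (Φ x) b a * (pd c (fun y => jacobian Φ y a i) x
        + ∑ d, ∑ e, christoffel G a d e (Φ x) * jacobian Φ x d c * jacobian Φ x e i)
      = ∑ a, ∑ b, pd c (fun y => jacobian Φ y a i) x * jacobian Φ x b j * G (Φ x) a b
        + ∑ b, ∑ d, ∑ e, jacobian Φ x b j * jacobian Φ x d c * jacobian Φ x e i *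
          ((1 / 2 : ℝ) * (pd d (fun y => G y e b) (Φ x) + pd e (fun y => G y d b) (Φ x)
            - pd b (fun y => G y d e) (Φ x))) := by
    simp only [← h.pair.lower_christoffel hy, mul_add, Finset.sum_add_distrib]
    congr 1
    · rw [Finset.sum_comm]
      refine Finset.sum_congr rfl fun a _ => Finset.sum_congr rfl fun b _ => ?_
      rw [h.pair.symm hy a b]; ring
    · refine Finset.sum_congr rfl fun b _ => ?_
      simp only [Finset.mul_sum]
      rw [Finset.sum_comm]
      refine Finset.sum_congr rfl fun d _ => ?_
      rw [Finset.sum_comm]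
      refine Finset.sum_congr rfl fun e _ => Finset.sum_congr rfl fun a _ => by ring
  rw [hR]
  have s1 := h.pd_jacobian_comm hx
  have s2 := h.pair.symm hy
  set A := jacobian Φ x
  set g := G (Φ x)
  set DA : Fin 3 → Fin 3 → Fin 3 → ℝ := fun c a i => pd c (fun y => jacobian Φ y a i) x
  set Dg : Fin 3 → Fin 3 → Fin 3 → ℝ := fun d a b => pd d (fun y => G y a b) (Φ x)
  -- The derivative ∂_c g'_{ij} as two ∂A terms, exchanged by i ↔ j, and one term in ∂g.
  have expand : ∀ c i j, (∑ a, ∑ b, (DA c a i * A b j * g a b + A a i * DA c b j * g a b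
      + A a i * A b j * ∑ d, A d c * Dg d a b))
      = (∑ a, ∑ b, DA c a i * A b j * g a b) + (∑ a, ∑ b, DA c a j * A b i * g a b)
        + ∑ d, ∑ a, ∑ b, A d c * A a i * A b j * Dg d a b := by
    intro c i j
    simp only [Finset.sum_add_distrib, Finset.mul_sum]
    congr 1
    · congr 1
      rw [Finset.sum_comm]
      exact Finset.sum_congr rfl fun b _ => Finset.sum_congr rfl fun a _ => by rw [s2 a b]; ring
    · rw [show (∑ d, ∑ a, ∑ b, A d c * A a i * A b j * Dg d a b)
          = ∑ a, ∑ d, ∑ b, A d c * A a i * A b j * Dg d a b from Finset.sum_comm]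
      refine Finset.sum_congr rfl fun a _ => ?_
      rw [Finset.sum_comm]
      refine Finset.sum_congr rfl fun d _ => Finset.sum_congr rfl fun b _ => by ring
  have e1 : ∀ c i j, (∑ a, ∑ b, DA c a i * A b j * g a b) = ∑ a, ∑ b, DA i a c * A b j * g a b :=
    fun c i j => Finset.sum_congr rfl fun a _ => Finset.sum_congr rfl fun b _ => by
      rw [show DA c a i = DA i a c from s1 c a i]
  have hQ : (∑ b, ∑ d, ∑ e, A b j * A d c * A e i *
          ((1 / 2 : ℝ) * (Dg d e b + Dg e d b - Dg b d e)))
      = (1 / 2 : ℝ) * ((∑ d, ∑ a, ∑ b, A d c * A a i * A b j * Dg d a b)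
        + (∑ d, ∑ a, ∑ b, A d i * A a c * A b j * Dg d a b)
        - ∑ d, ∑ a, ∑ b, A d j * A a c * A b i * Dg d a b) := by
    simp only [Fin.sum_univ_three]
    ring
  change (1 / 2 : ℝ) * ((∑ a, ∑ b, (DA c a i * A b j * g a b + A a i * DA c b j * g a b
      + A a i * A b j * ∑ d, A d c * Dg d a b)) + (∑ a, ∑ b, (DA i a c * A b j * g a b
      + A a c * DA i b j * g a b + A a c * A b j * ∑ d, A d i * Dg d a b))
      - (∑ a, ∑ b, (DA j a c * A b i * g a b
      + A a c * DA j b i * g a b + A a c * A b i * ∑ d, A d j * Dg d a b)))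
    = (∑ a, ∑ b, DA c a i * A b j * g a b) + (∑ b, ∑ d, ∑ e, A b j * A d c * A e i *
          ((1 / 2 : ℝ) * (Dg d e b + Dg e d b - Dg b d e)))
  rw [expand, expand, expand, hQ, e1 i c j, e1 j c i, e1 j i c]
  ring

/-- The upper index is kept multiplied by A, so that the law can be used against w' = Aw without
inverting the Jacobian. -/
theorem christoffel_pullback (h : IsCoordChange U V G f Φ) (hx : x ∈ V) (c i a : Fin 3) :
    ∑ m, jacobian Φ x a m * christoffel (pullback Φ G) m c i x =
      pd c (fun y => jacobian Φ y a i) x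
        + ∑ d, ∑ e, christoffel G a d e (Φ x) * jacobian Φ x d c * jacobian Φ x e i := by
  -- The defect of the claimed law. The lowered law says that Aᵀg annihilates it, and Aᵀg is
  -- invertible.
  set z : Fin 3 → ℝ := fun a => (∑ m, jacobian Φ x a m * christoffel (pullback Φ G) m c i x)
    - (pd c (fun y => jacobian Φ y a i) x
        + ∑ d, ∑ e, christoffel G a d e (Φ x) * jacobian Φ x d c * jacobian Φ x e i) with hz
  have hdet : ((jacobian Φ x).transpose * G (Φ x)).det ≠ 0 := by
    rw [Matrix.det_mul, Matrix.det_transpose]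
    exact mul_ne_zero (h.det x hx) (h.pair.det_ne_zero (h.maps hx))
  have h0 : Matrix.mulVec ((jacobian Φ x).transpose * G (Φ x)) z = 0 := by
    ext j
    have key := h.lower_christoffel_pullback hx c i j
    have e : ∑ m, pullback Φ G x j m * christoffel (pullback Φ G) m c i x =
        ∑ b, ∑ a, jacobian Φ x b j * G (Φ x) b a *
          ∑ m, jacobian Φ x a m * christoffel (pullback Φ G) m c i x := by
      simp only [pullback, Finset.sum_mul, Finset.mul_sum]
      rw [Finset.sum_comm]
      refine Finset.sum_congr rfl fun b _ => ?_
      rw [Finset.sum_comm]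
      refine Finset.sum_congr rfl fun a _ => Finset.sum_congr rfl fun m _ => by ring
    rw [e, ← sub_eq_zero, ← Finset.sum_sub_distrib] at key
    simp only [← Finset.sum_sub_distrib, ← mul_sub] at key
    rw [Finset.sum_comm] at key
    simpa [Matrix.mulVec, dotProduct, Matrix.mul_apply, Finset.sum_mul] using key
  have := congrFun (Matrix.eq_zero_of_mulVec_eq_zero hdet h0) a
  exact sub_eq_zero.1 this

end IsCoordChange

/-! ### Quantities: smoothness, polynomiality and naturality -/

/-- A scalar quantity formed from a metric and a function. -/
abbrev Quantity : Type := MetricField → (Pt → ℝ) → Pt → ℝ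

/-- The quantity is smooth for smooth metrics and functions. -/
def IsSmooth (q : Quantity) : Prop :=
  ∀ ⦃U : Set Pt⦄ ⦃G : MetricField⦄ ⦃f : Pt → ℝ⦄, IsMetricPair G f U → ContDiffOn ℝ ∞ (q G f) U

/-- The quantity is given by a polynomial in the jet variables. -/
def IsPoly (q : Quantity) : Prop :=
  ∃ P : MvPolynomial JetVar ℝ, ∀ {U : Set Pt} {G : MetricField} {f : Pt → ℝ},
    IsMetricPair G f U → ∀ x ∈ U, q G f x = evalJet P G f x

/-- The quantity behaves as a scalar under changes of coordinates. -/
def IsNatural (q : Quantity) : Prop :=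
  ∀ ⦃U V : Set Pt⦄ ⦃G : MetricField⦄ ⦃f : Pt → ℝ⦄ ⦃Φ : Pt → Pt⦄, IsCoordChange U V G f Φ →
    ∀ x ∈ V, q (pullback Φ G) (f ∘ Φ) x = q G f (Φ x)

/-- The family behaves as a covector under changes of coordinates. -/
def IsNatural₁ (w : Fin 3 → Quantity) : Prop :=
  ∀ ⦃U V : Set Pt⦄ ⦃G : MetricField⦄ ⦃f : Pt → ℝ⦄ ⦃Φ : Pt → Pt⦄, IsCoordChange U V G f Φ →
    ∀ x ∈ V, ∀ i, w i (pullback Φ G) (f ∘ Φ) x = ∑ a, jacobian Φ x a i * w a G f (Φ x)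

/-- The family behaves as a covariant tensor of rank two under changes of coordinates. -/
def IsNatural₂ (T : Fin 3 → Fin 3 → Quantity) : Prop :=
  ∀ ⦃U V : Set Pt⦄ ⦃G : MetricField⦄ ⦃f : Pt → ℝ⦄ ⦃Φ : Pt → Pt⦄, IsCoordChange U V G f Φ →
    ∀ x ∈ V, ∀ i j, T i j (pullback Φ G) (f ∘ Φ) x =
      ∑ a, ∑ b, jacobian Φ x a i * jacobian Φ x b j * T a b G f (Φ x)

/-- The family behaves as a covariant tensor of rank three under changes of coordinates. -/
def IsNatural₃ (T : Fin 3 → Fin 3 → Fin 3 → Quantity) : Prop :=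
  ∀ ⦃U V : Set Pt⦄ ⦃G : MetricField⦄ ⦃f : Pt → ℝ⦄ ⦃Φ : Pt → Pt⦄, IsCoordChange U V G f Φ →
    ∀ x ∈ V, ∀ i j k, T i j k (pullback Φ G) (f ∘ Φ) x =
      ∑ a, ∑ b, ∑ c, jacobian Φ x a i * jacobian Φ x b j * jacobian Φ x c k *
        T a b c G f (Φ x)

/-! ### Closure of smooth and of polynomial quantities under algebraic operations -/

section Closure

variable {p q : Quantity}

theorem IsSmooth.differentiableAt (hq : IsSmooth q) {U : Set Pt} {G : MetricField} {f : Pt → ℝ}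
    (h : IsMetricPair G f U) {x : Pt} (hx : x ∈ U) : DifferentiableAt ℝ (q G f) x :=
  differentiableAt_of_contDiffOn h.isOpen (hq h) hx

theorem IsSmooth.const (r : ℝ) : IsSmooth fun _ _ _ => r := fun _ _ _ _ => contDiffOn_const

theorem IsSmooth.add (hp : IsSmooth p) (hq : IsSmooth q) :
    IsSmooth fun G f x => p G f x + q G f x := fun _ _ _ h => (hp h).add (hq h)

theorem IsSmooth.sub (hp : IsSmooth p) (hq : IsSmooth q) :
    IsSmooth fun G f x => p G f x - q G f x := fun _ _ _ h => (hp h).sub (hq h)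

theorem IsSmooth.mul (hp : IsSmooth p) (hq : IsSmooth q) :
    IsSmooth fun G f x => p G f x * q G f x := fun _ _ _ h => (hp h).mul (hq h)

theorem IsSmooth.sum {ι : Type*} {s : Finset ι} {q : ι → Quantity} (hq : ∀ a, IsSmooth (q a)) :
    IsSmooth fun G f x => ∑ a ∈ s, q a G f x :=
  fun _ _ _ h => ContDiffOn.sum fun a _ => hq a h

theorem IsSmooth.pd (hq : IsSmooth q) (c : Fin 3) : IsSmooth fun G f => pd c (q G f) :=
  fun _ _ _ h => contDiffOn_pd h.isOpen (hq h) c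

theorem isSmooth_metric (i j : Fin 3) : IsSmooth fun G _ x => G x i j := fun _ _ _ h => h.smooth i j

theorem isSmooth_ginv (i j : Fin 3) : IsSmooth fun G _ x => ginv G x i j :=
  fun _ _ _ h => h.contDiffOn_ginv i j

theorem isSmooth_christoffel (l i j : Fin 3) : IsSmooth fun G _ x => christoffel G l i j x :=
  fun _ _ _ h => h.contDiffOn_christoffel l i j

theorem IsPoly.congr (hp : IsPoly p)
    (h : ∀ {U : Set Pt} {G : MetricField} {f : Pt → ℝ}, IsMetricPair G f U → ∀ x ∈ U,
      q G f x = p G f x) : IsPoly q := by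
  obtain ⟨P, hP⟩ := hp
  exact ⟨P, fun hG x hx => (h hG x hx).trans (hP hG x hx)⟩

theorem IsPoly.const (r : ℝ) : IsPoly fun _ _ _ => r :=
  ⟨MvPolynomial.C r, fun _ _ _ => by simp [evalJet]⟩

theorem IsPoly.add (hp : IsPoly p) (hq : IsPoly q) : IsPoly fun G f x => p G f x + q G f x := by
  obtain ⟨P, hP⟩ := hp
  obtain ⟨Q, hQ⟩ := hq
  exact ⟨P + Q, fun h x hx => by simp [evalJet, hP h x hx, hQ h x hx]⟩

theorem IsPoly.mul (hp : IsPoly p) (hq : IsPoly q) : IsPoly fun G f x => p G f x * q G f x := by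
  obtain ⟨P, hP⟩ := hp
  obtain ⟨Q, hQ⟩ := hq
  exact ⟨P * Q, fun h x hx => by simp [evalJet, hP h x hx, hQ h x hx]⟩

theorem IsPoly.sub (hp : IsPoly p) (hq : IsPoly q) : IsPoly fun G f x => p G f x - q G f x := by
  obtain ⟨P, hP⟩ := hp
  obtain ⟨Q, hQ⟩ := hq
  exact ⟨P - Q, fun h x hx => by simp [evalJet, hP h x hx, hQ h x hx]⟩

theorem IsPoly.sum {ι : Type*} {s : Finset ι} {q : ι → Quantity} (hq : ∀ a, IsPoly (q a)) :
    IsPoly fun G f x => ∑ a ∈ s, q a G f x := by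
  choose P hP using hq
  exact ⟨∑ a ∈ s, P a, fun h x hx => by simp [evalJet, hP _ h x hx]⟩

theorem isPoly_ginv (i j : Fin 3) : IsPoly fun G _ x => ginv G x i j :=
  ⟨MvPolynomial.X (.metric i j), fun _ _ _ => by simp [evalJet, jet]⟩

theorem isPoly_covD (k : ℕ) (a : Fin k → Fin 3) : IsPoly fun G f x => covD G f k x a :=
  ⟨MvPolynomial.X (.deriv k a), fun _ _ _ => by simp [evalJet, jet]⟩

end Closure

/-! ### Covariant derivatives in low rank -/

/-- The covariant derivative of a covector. -/
def cov₁ (w : Fin 3 → Quantity) (c i : Fin 3) : Quantity := fun G f x =>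
  pd c (w i G f) x - ∑ m, christoffel G m c i x * w m G f x

/-- The covariant derivative of a covariant tensor of rank two. -/
def cov₂ (T : Fin 3 → Fin 3 → Quantity) (c i j : Fin 3) : Quantity := fun G f x =>
  pd c (T i j G f) x - ∑ m, christoffel G m c i x * T m j G f x
    - ∑ m, christoffel G m c j x * T i m G f x

theorem isSmooth_cov₁ {w : Fin 3 → Quantity} (hw : ∀ i, IsSmooth (w i)) (c i : Fin 3) :
    IsSmooth (cov₁ w c i) :=
  ((hw i).pd c).sub (.sum fun m => (isSmooth_christoffel m c i).mul (hw m))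

theorem IsNatural.pd {q : Quantity} (hs : IsSmooth q) (hq : IsNatural q) :
    IsNatural₁ fun i G f => pd i (q G f) := by
  intro U V G f Φ h x hx i
  rw [← h.pd_comp hx (hs h.pair)]
  exact pd_congr h.isOpen (fun y hy => hq h y hy) hx i

/-- Differentiating w' = Aw produces an inhomogeneous term ∂A·w, which the ∂A in the Christoffel law
cancels. -/
theorem IsNatural₁.cov {w : Fin 3 → Quantity} (hs : ∀ i, IsSmooth (w i)) (hw : IsNatural₁ w) :
    IsNatural₂ (cov₁ w) := by
  intro U V G f Φ h x hx c i
  have dA : ∀ a i, DifferentiableAt ℝ (fun y => jacobian Φ y a i) x := fun a i =>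
    differentiableAt_of_contDiffOn h.isOpen (h.contDiffOn_jacobian a i) hx
  have dw : ∀ a, DifferentiableAt ℝ (fun y => w a G f (Φ y)) x := fun a =>
    differentiableAt_of_contDiffOn h.isOpen (h.contDiffOn_comp (hs a h.pair)) hx
  have e : pd c (w i (pullback Φ G) (f ∘ Φ)) x = ∑ a, (pd c (fun y => jacobian Φ y a i) x *
      w a G f (Φ x) + jacobian Φ x a i * ∑ d, jacobian Φ x d c * pd d (w a G f) (Φ x)) := by
    rw [pd_congr h.isOpen (fun y hy => hw h y hy i) hx,
      pd_sum (w := fun a y => jacobian Φ y a i * w a G f (Φ y)) fun a _ => (dA a i).mul (dw a)]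
    refine Finset.sum_congr rfl fun a _ => ?_
    rw [pd_mul (dA a i) (dw a), h.pd_comp hx (hs a h.pair)]
  have hΓ := h.christoffel_pullback hx c i
  simp only [cov₁, e, hw h x hx]
  generalize w = w at *
  generalize jacobian Φ x = A at *
  simp only [Fin.sum_univ_three] at hΓ ⊢
  -- The Christoffel law with upper index a enters multiplied by w_a.
  linear_combination -(w 0 G f (Φ x)) * hΓ 0 - (w 1 G f (Φ x)) * hΓ 1 - (w 2 G f (Φ x)) * hΓ 2

/-- As for covectors, with one Christoffel correction for each of the two factors A that get
differentiated. -/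
theorem IsNatural₂.cov {T : Fin 3 → Fin 3 → Quantity} (hs : ∀ i j, IsSmooth (T i j))
    (hT : IsNatural₂ T) : IsNatural₃ (cov₂ T) := by
  intro U V G f Φ h x hx c i j
  have dA : ∀ a i, DifferentiableAt ℝ (fun y => jacobian Φ y a i) x := fun a i =>
    differentiableAt_of_contDiffOn h.isOpen (h.contDiffOn_jacobian a i) hx
  have dT : ∀ a b, DifferentiableAt ℝ (fun y => T a b G f (Φ y)) x := fun a b =>
    differentiableAt_of_contDiffOn h.isOpen (h.contDiffOn_comp (hs a b h.pair)) hx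
  have d2 : ∀ a b, DifferentiableAt ℝ (fun y => jacobian Φ y a i * jacobian Φ y b j) x :=
    fun a b => (dA a i).mul (dA b j)
  have d3 : ∀ a b, DifferentiableAt ℝ
      (fun y => jacobian Φ y a i * jacobian Φ y b j * T a b G f (Φ y)) x :=
    fun a b => (d2 a b).mul (dT a b)
  have e : pd c (T i j (pullback Φ G) (f ∘ Φ)) x = ∑ a, ∑ b,
      ((pd c (fun y => jacobian Φ y a i) x * jacobian Φ x b j +
        jacobian Φ x a i * pd c (fun y => jacobian Φ y b j) x) * T a b G f (Φ x)
      + jacobian Φ x a i * jacobian Φ x b j *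
        ∑ d, jacobian Φ x d c * pd d (T a b G f) (Φ x)) := by
    rw [pd_congr h.isOpen (fun y hy => hT h y hy i j) hx,
      pd_sum (w := fun a y => ∑ b, jacobian Φ y a i * jacobian Φ y b j * T a b G f (Φ y))
        (fun a _ => DifferentiableAt.fun_sum fun b _ => d3 a b)]
    refine Finset.sum_congr rfl fun a _ => ?_
    rw [pd_sum (w := fun b y => jacobian Φ y a i * jacobian Φ y b j * T a b G f (Φ y))
      (fun b _ => d3 a b)]
    refine Finset.sum_congr rfl fun b _ => ?_
    rw [pd_mul (d2 a b) (dT a b), pd_mul (dA a i) (dA b j), h.pd_comp hx (hs a b h.pair)]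
  have hΓ := h.christoffel_pullback hx c
  have e1 : ∑ m, christoffel (pullback Φ G) m c i x * (∑ a, ∑ b,
      jacobian Φ x a m * jacobian Φ x b j * T a b G f (Φ x)) = ∑ a, ∑ b,
      (pd c (fun y => jacobian Φ y a i) x + ∑ d, ∑ e, christoffel G a d e (Φ x) *
        jacobian Φ x d c * jacobian Φ x e i) * jacobian Φ x b j * T a b G f (Φ x) := by
    simp only [← hΓ]
    simp only [Fin.sum_univ_three]
    ring
  have e2 : ∑ m, christoffel (pullback Φ G) m c j x * (∑ a, ∑ b,
      jacobian Φ x a i * jacobian Φ x b m * T a b G f (Φ x)) = ∑ a, ∑ b,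
      (pd c (fun y => jacobian Φ y b j) x + ∑ d, ∑ e, christoffel G b d e (Φ x) *
        jacobian Φ x d c * jacobian Φ x e j) * jacobian Φ x a i * T a b G f (Φ x) := by
    simp only [← hΓ]
    simp only [Fin.sum_univ_three]
    ring
  simp only [cov₂, e, hT h x hx]
  rw [e1, e2]
  generalize jacobian Φ x = A at *
  simp only [Fin.sum_univ_three]
  ring

/-- A scalar quantity built from the jet variables, with its gradient. -/
structure IsTensor₀ (q : Quantity) : Prop where
  smooth : IsSmooth q
  natural : IsNatural q
  poly : IsPoly q
  poly_cov : ∀ c, IsPoly fun G f => pd c (q G f)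

/-- A covector built from the jet variables, with its covariant derivative. -/
structure IsTensor₁ (w : Fin 3 → Quantity) : Prop where
  smooth : ∀ i, IsSmooth (w i)
  natural : IsNatural₁ w
  poly : ∀ i, IsPoly (w i)
  poly_cov : ∀ c i, IsPoly (cov₁ w c i)

/-- A covariant tensor of rank two built from the jet variables, with its covariant derivative. -/
structure IsTensor₂ (T : Fin 3 → Fin 3 → Quantity) : Prop where
  smooth : ∀ i j, IsSmooth (T i j)
  natural : IsNatural₂ T
  poly : ∀ i j, IsPoly (T i j)
  poly_cov : ∀ c i j, IsPoly (cov₂ T c i j)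

theorem pd_eq_cov₁ (w : Fin 3 → Quantity) (G : MetricField) (f : Pt → ℝ) (x : Pt) (c i : Fin 3) :
    pd c (w i G f) x = cov₁ w c i G f x + ∑ m, christoffel G m c i x * w m G f x := by
  simp [cov₁]

/-! ### Contractions absorb the Jacobian -/

section Contraction

variable {A P P' : Fin 3 → Fin 3 → ℝ}

theorem contract_pair (hP : ∀ a b, ∑ i, ∑ j, A a i * P' i j * A b j = P a b) (s t : Fin 3 → ℝ) :
    ∑ i, ∑ j, P' i j * (∑ a, A a i * s a) * (∑ b, A b j * t b) = ∑ a, ∑ b, P a b * s a * t b := by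
  simp only [← hP]
  simp only [Fin.sum_univ_three]
  ring

theorem contract_trace (hP : ∀ a b, ∑ i, ∑ j, A a i * P' i j * A b j = P a b)
    (T : Fin 3 → Fin 3 → ℝ) :
    ∑ i, ∑ j, P' i j * (∑ a, ∑ b, A a i * A b j * T a b) = ∑ a, ∑ b, P a b * T a b := by
  simp only [← hP]
  simp only [Fin.sum_univ_three]
  ring

end Contraction

/-- `g^{ij} v_i w_j`. -/
def inner₁ (v w : Fin 3 → Quantity) : Quantity := fun G f x =>
  ∑ i, ∑ j, ginv G x i j * v i G f x * w j G f x

/-- `g^{ij} T_{ij}`. -/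
def trace₂ (T : Fin 3 → Fin 3 → Quantity) : Quantity := fun G f x =>
  ∑ i, ∑ j, ginv G x i j * T i j G f x

/-- `g^{jk} T_{ij} w_k`. -/
def apply₂ (T : Fin 3 → Fin 3 → Quantity) (w : Fin 3 → Quantity) (i : Fin 3) : Quantity :=
  fun G f x => ∑ j, ∑ k, ginv G x j k * T i j G f x * w k G f x

/-- `g^{jl} T_{ij} S_{kl}`. -/
def comp₂ (T S : Fin 3 → Fin 3 → Quantity) (i k : Fin 3) : Quantity :=
  fun G f x => ∑ j, ∑ l, ginv G x j l * T i j G f x * S k l G f x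

/-- Since ∇g⁻¹ = 0, the derivative of g^{ij}u_{ij} is the contraction of the covariant derivative of
u. This is why gradients of contractions stay polynomial in the covariant jet. -/
theorem pd_sum_ginv_mul {U : Set Pt} {G : MetricField} {f : Pt → ℝ} (h : IsMetricPair G f U)
    {x : Pt} (hx : x ∈ U) {u : Fin 3 → Fin 3 → Pt → ℝ}
    (hu : ∀ i j, DifferentiableAt ℝ (u i j) x) (c : Fin 3) :
    pd c (fun y => ∑ i, ∑ j, ginv G y i j * u i j y) x = ∑ i, ∑ j, ginv G x i j *
      (pd c (u i j) x - ∑ m, christoffel G m c i x * u m j x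
        - ∑ m, christoffel G m c j x * u i m x) := by
  have dP : ∀ i j, DifferentiableAt ℝ (fun y => ginv G y i j) x := fun i j =>
    differentiableAt_of_contDiffOn h.isOpen (h.contDiffOn_ginv i j) hx
  have e : pd c (fun y => ∑ i, ∑ j, ginv G y i j * u i j y) x
      = ∑ i, ∑ j, (pd c (fun y => ginv G y i j) x * u i j x + ginv G x i j * pd c (u i j) x) := by
    rw [pd_sum (w := fun i y => ∑ j, ginv G y i j * u i j y)
      (fun i _ => DifferentiableAt.fun_sum fun j _ => (dP i j).mul (hu i j))]
    refine Finset.sum_congr rfl fun i _ => ?_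
    rw [pd_sum (w := fun j y => ginv G y i j * u i j y) (fun j _ => (dP i j).mul (hu i j))]
    exact Finset.sum_congr rfl fun j _ => pd_mul (dP i j) (hu i j) c
  rw [e]
  simp only [h.pd_ginv hx, Fin.sum_univ_three]
  ring

namespace IsTensor₀

variable {p q : Quantity}

theorem const (r : ℝ) : IsTensor₀ fun _ _ _ => r :=
  ⟨.const r, fun _ _ _ _ _ _ _ _ => rfl, .const r, fun c => (IsPoly.const 0).congr fun _ _ _ => pd_const r c⟩

theorem add (hp : IsTensor₀ p) (hq : IsTensor₀ q) : IsTensor₀ fun G f x => p G f x + q G f x where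
  smooth := hp.smooth.add hq.smooth
  natural _ _ _ _ _ h x hx := by simp only [hp.natural h x hx, hq.natural h x hx]
  poly := hp.poly.add hq.poly
  poly_cov c := ((hp.poly_cov c).add (hq.poly_cov c)).congr fun h _ hx =>
    pd_add (hp.smooth.differentiableAt h hx) (hq.smooth.differentiableAt h hx) c

theorem mul (hp : IsTensor₀ p) (hq : IsTensor₀ q) : IsTensor₀ fun G f x => p G f x * q G f x where
  smooth := hp.smooth.mul hq.smooth
  natural _ _ _ _ _ h x hx := by simp only [hp.natural h x hx, hq.natural h x hx]
  poly := hp.poly.mul hq.poly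
  poly_cov c := (((hp.poly_cov c).mul hq.poly).add (hp.poly.mul (hq.poly_cov c))).congr
    fun h _ hx => pd_mul (hp.smooth.differentiableAt h hx) (hq.smooth.differentiableAt h hx) c

end IsTensor₀

theorem IsTensor₀.congr {p q : Quantity} (hp : IsTensor₀ p)
    (h : ∀ {U : Set Pt} {G : MetricField} {f : Pt → ℝ}, IsMetricPair G f U → ∀ x ∈ U,
      q G f x = p G f x) : IsTensor₀ q where
  smooth _ _ _ hG := (hp.smooth hG).congr fun x hx => h hG x hx
  natural _ _ _ _ _ hΦ x hx := by
    rw [h hΦ.isMetricPair x hx, h hΦ.pair _ (hΦ.maps hx), hp.natural hΦ x hx]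
  poly := hp.poly.congr h
  poly_cov c := (hp.poly_cov c).congr fun hG x hx => pd_congr hG.isOpen (h hG) hx c

/-- The gradient of a trace is the trace of the covariant derivative. -/
theorem IsTensor₂.trace {T : Fin 3 → Fin 3 → Quantity} (hT : IsTensor₂ T) :
    IsTensor₀ (trace₂ T) where
  smooth := .sum fun i => .sum fun j => (isSmooth_ginv i j).mul (hT.smooth i j)
  natural _ _ _ _ _ h x hx := by
    simp only [trace₂, hT.natural h x hx]
    exact contract_trace (h.ginv_pullback hx) _
  poly := .sum fun i => .sum fun j => (isPoly_ginv i j).mul (hT.poly i j)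
  poly_cov c := by
    refine (IsPoly.sum (s := Finset.univ) fun i => IsPoly.sum (s := Finset.univ) fun j =>
      (isPoly_ginv i j).mul (hT.poly_cov c i j)).congr fun h x hx => ?_
    exact pd_sum_ginv_mul h hx (fun i j => (hT.smooth i j).differentiableAt h hx) c

theorem IsTensor₁.outer {v w : Fin 3 → Quantity} (hv : IsTensor₁ v) (hw : IsTensor₁ w) :
    IsTensor₂ fun i j G f x => v i G f x * w j G f x where
  smooth i j := (hv.smooth i).mul (hw.smooth j)
  natural _ _ _ _ _ h x hx i j := by
    simp only [hv.natural h x hx, hw.natural h x hx, Fin.sum_univ_three]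
    ring
  poly i j := (hv.poly i).mul (hw.poly j)
  poly_cov c i j := by
    refine (((hv.poly_cov c i).mul (hw.poly j)).add
      ((hv.poly i).mul (hw.poly_cov c j))).congr fun h x hx => ?_
    simp only [cov₂, pd_mul ((hv.smooth i).differentiableAt h hx)
      ((hw.smooth j).differentiableAt h hx), pd_eq_cov₁, Fin.sum_univ_three]
    ring

theorem IsTensor₁.inner {v w : Fin 3 → Quantity} (hv : IsTensor₁ v) (hw : IsTensor₁ w) :
    IsTensor₀ (inner₁ v w) := by
  have e : inner₁ v w = trace₂ fun i j G f x => v i G f x * w j G f x := by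
    funext G f x
    simp only [inner₁, trace₂, mul_assoc]
  rw [e]
  exact (hv.outer hw).trace

theorem IsTensor₂.comp {T S : Fin 3 → Fin 3 → Quantity} (hT : IsTensor₂ T) (hS : IsTensor₂ S) :
    IsTensor₂ (comp₂ T S) where
  smooth i k := .sum fun j => .sum fun l =>
    ((isSmooth_ginv j l).mul (hT.smooth i j)).mul (hS.smooth k l)
  natural U V G f Φ h x hx i k := by
    -- The Jacobian of the contracted index is pulled outside, so that for fixed free indices both
    -- factors are covectors and `contract_pair` applies.
    have e1 : ∀ j, T i j (pullback Φ G) (f ∘ Φ) x = ∑ b, jacobian Φ x b j *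
        ∑ a, jacobian Φ x a i * T a b G f (Φ x) := fun j => by
      rw [hT.natural h x hx, Finset.sum_comm]
      simp only [Finset.mul_sum]
      exact Finset.sum_congr rfl fun b _ => Finset.sum_congr rfl fun a _ => by ring
    have e2 : ∀ j, S k j (pullback Φ G) (f ∘ Φ) x = ∑ b, jacobian Φ x b j *
        ∑ a, jacobian Φ x a k * S a b G f (Φ x) := fun j => by
      rw [hS.natural h x hx, Finset.sum_comm]
      simp only [Finset.mul_sum]
      exact Finset.sum_congr rfl fun b _ => Finset.sum_congr rfl fun a _ => by ring
    simp only [comp₂, e1, e2]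
    rw [contract_pair (h.ginv_pullback hx)]
    simp only [Fin.sum_univ_three]
    ring
  poly i k := .sum fun j => .sum fun l => ((isPoly_ginv j l).mul (hT.poly i j)).mul (hS.poly k l)
  poly_cov c i k := by
    refine (IsPoly.sum (s := Finset.univ) fun j => IsPoly.sum (s := Finset.univ) fun l =>
      -- The candidate is the Leibniz expression g^{jl}(∇_c T_{ij} S_{kl} + T_{ij} ∇_c S_{kl}). The
      -- Christoffel terms of the contracted indices cancel by `pd_sum_ginv_mul`; those of i and k
      -- are the ones in `cov₂`.
      (isPoly_ginv j l).mul (((hT.poly_cov c i j).mul (hS.poly k l)).add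
        ((hT.poly i j).mul (hS.poly_cov c k l)))).congr fun {U G f} h x hx => ?_
    have dT := fun i j => (hT.smooth i j).differentiableAt h hx
    have dS := fun i j => (hS.smooth i j).differentiableAt h hx
    have e := pd_sum_ginv_mul h hx (u := fun j l y => T i j G f y * S k l G f y)
      (fun j l => (dT i j).mul (dS k l)) c
    simp only [fun j l => pd_mul (dT i j) (dS k l) c, ← mul_assoc] at e
    have e' : pd c (comp₂ T S i k G f) x = _ := e
    simp only [cov₂]
    rw [e']
    simp only [comp₂]
    simp only [Fin.sum_univ_three]
    ring

theorem IsNatural₂.apply {T : Fin 3 → Fin 3 → Quantity} {w : Fin 3 → Quantity}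
    (hT : IsNatural₂ T) (hw : IsNatural₁ w) : IsNatural₁ (apply₂ T w) := by
  intro U V G f Φ h x hx i
  have e1 : ∀ j, T i j (pullback Φ G) (f ∘ Φ) x = ∑ b, jacobian Φ x b j *
      ∑ a, jacobian Φ x a i * T a b G f (Φ x) := fun j => by
    rw [hT h x hx, Finset.sum_comm]
    simp only [Finset.mul_sum]
    exact Finset.sum_congr rfl fun b _ => Finset.sum_congr rfl fun a _ => by ring
  simp only [apply₂, e1, hw h x hx]
  rw [contract_pair (h.ginv_pullback hx)]
  simp only [Fin.sum_univ_three]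
  ring

theorem IsTensor₂.apply {T : Fin 3 → Fin 3 → Quantity} {w : Fin 3 → Quantity}
    (hT : IsTensor₂ T) (hw : IsTensor₁ w) : IsTensor₁ (apply₂ T w) where
  smooth i := .sum fun j => .sum fun k =>
    ((isSmooth_ginv j k).mul (hT.smooth i j)).mul (hw.smooth k)
  natural := hT.natural.apply hw.natural
  poly i := .sum fun j => .sum fun l => ((isPoly_ginv j l).mul (hT.poly i j)).mul (hw.poly l)
  poly_cov c i := by
    refine (IsPoly.sum (s := Finset.univ) fun j => IsPoly.sum (s := Finset.univ) fun l =>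
      (isPoly_ginv j l).mul (((hT.poly_cov c i j).mul (hw.poly l)).add
        ((hT.poly i j).mul (hw.poly_cov c l)))).congr fun {U G f} h x hx => ?_
    have dT := fun i j => (hT.smooth i j).differentiableAt h hx
    have dw := fun i => (hw.smooth i).differentiableAt h hx
    have e := pd_sum_ginv_mul h hx (u := fun j l y => T i j G f y * w l G f y)
      (fun j l => (dT i j).mul (dw l)) c
    simp only [fun j l => pd_mul (dT i j) (dw l) c, ← mul_assoc] at e
    have e' : pd c (apply₂ T w i G f) x = _ := e
    simp only [cov₁, cov₂]
    rw [e']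
    simp only [apply₂]
    simp only [Fin.sum_univ_three]
    ring

theorem IsTensor₂.add {T S : Fin 3 → Fin 3 → Quantity} (hT : IsTensor₂ T) (hS : IsTensor₂ S) :
    IsTensor₂ fun i j G f x => T i j G f x + S i j G f x where
  smooth i j := (hT.smooth i j).add (hS.smooth i j)
  natural _ _ _ _ _ h x hx i j := by
    simp only [hT.natural h x hx, hS.natural h x hx, mul_add, Finset.sum_add_distrib]
  poly i j := (hT.poly i j).add (hS.poly i j)
  poly_cov c i j := by
    refine ((hT.poly_cov c i j).add (hS.poly_cov c i j)).congr fun h x hx => ?_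
    simp only [cov₂, pd_add ((hT.smooth i j).differentiableAt h hx)
      ((hS.smooth i j).differentiableAt h hx), mul_add, Finset.sum_add_distrib]
    ring

theorem IsTensor₀.smul {q : Quantity} {T : Fin 3 → Fin 3 → Quantity} (hq : IsTensor₀ q)
    (hT : IsTensor₂ T) : IsTensor₂ fun i j G f x => q G f x * T i j G f x where
  smooth i j := hq.smooth.mul (hT.smooth i j)
  natural _ _ _ _ _ h x hx i j := by
    simp only [hq.natural h x hx, hT.natural h x hx, Finset.mul_sum]
    exact Finset.sum_congr rfl fun b _ => Finset.sum_congr rfl fun a _ => by ring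
  poly i j := hq.poly.mul (hT.poly i j)
  poly_cov c i j := by
    refine (((hq.poly_cov c).mul (hT.poly i j)).add (hq.poly.mul (hT.poly_cov c i j))).congr
      fun h x hx => ?_
    simp only [cov₂, pd_mul (hq.smooth.differentiableAt h hx)
      ((hT.smooth i j).differentiableAt h hx), Fin.sum_univ_three]
    ring

theorem isNatural₂_metric : IsNatural₂ fun i j G _ x => G x i j :=
  fun _ _ _ _ _ _ _ _ _ _ => rfl

/-- The components g_{ij} are not polynomial in g^{ij}, so the metric is no `IsTensor₂`. Its
naturality and this vanishing are the substitutes used for φ. -/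
theorem cov₂_metric {U : Set Pt} {G : MetricField} {f : Pt → ℝ} (h : IsMetricPair G f U)
    {x : Pt} (hx : x ∈ U) (c i j : Fin 3) : cov₂ (fun i j G _ x => G x i j) c i j G f x = 0 := by
  simp only [cov₂, h.pd_metric hx]
  ring

/-! ### Components of tensors of low rank -/

section Components

variable {G : MetricField}

theorem vec_one_eta (a : Fin 1 → Fin 3) : ![a 0] = a := by
  ext p; fin_cases p; rfl

theorem vec_two_eta (a : Fin 2 → Fin 3) : ![a 0, a 1] = a := by
  ext p; fin_cases p <;> rfl

theorem vec_three_eta (a : Fin 3 → Fin 3) : ![a 0, a 1, a 2] = a := by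
  ext p; fin_cases p <;> rfl

theorem sum_vec_one (F : (Fin 1 → Fin 3) → ℝ) : ∑ a, F a = ∑ i, F ![i] :=
  Fintype.sum_equiv (Equiv.funUnique (Fin 1) (Fin 3)) _ _ fun a => by
    rw [show (Equiv.funUnique (Fin 1) (Fin 3)) a = a 0 from rfl, vec_one_eta]

theorem sum_vec_two (F : (Fin 2 → Fin 3) → ℝ) : ∑ a, F a = ∑ i, ∑ j, F ![i, j] := by
  rw [← Fintype.sum_prod_type' (f := fun i j => F ![i, j])]
  exact Fintype.sum_equiv (finTwoArrowEquiv (Fin 3)) _ _ fun a => by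
    change F a = F ![a 0, a 1]
    rw [vec_two_eta]

theorem sum_vec_three (F : (Fin 3 → Fin 3) → ℝ) :
    ∑ a, F a = ∑ i, ∑ j, ∑ k, F ![i, j, k] := by
  have e : ∀ i, ∑ j, ∑ k, F ![i, j, k] = ∑ b : Fin 2 → Fin 3, F (Matrix.vecCons i b) :=
    fun i => (sum_vec_two fun b => F (Matrix.vecCons i b)).symm
  simp only [e]
  rw [← Fintype.sum_prod_type' (f := fun i (b : Fin 2 → Fin 3) => F (Matrix.vecCons i b))]
  exact (Fintype.sum_equiv (Fin.consEquiv fun _ => Fin 3) _ _ fun a => rfl).symm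

theorem up_one (T : Tensor 1) (x : Pt) (i : Fin 3) :
    up G T x ![i] = ∑ j, ginv G x i j * T x ![j] := by
  simp [up, sum_vec_one]

theorem up_two (T : Tensor 2) (x : Pt) (i j : Fin 3) :
    up G T x ![i, j] = ∑ a, ∑ b, ginv G x i a * ginv G x j b * T x ![a, b] := by
  simp [up, sum_vec_two, Fin.prod_univ_two]

theorem up_three (T : Tensor 3) (x : Pt) (i j k : Fin 3) :
    up G T x ![i, j, k] = ∑ a, ∑ b, ∑ c, ginv G x i a * ginv G x j b * ginv G x k c *
      T x ![a, b, c] := by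
  simp [up, sum_vec_three, Fin.prod_univ_three]

theorem nabla_one (T : Tensor 1) (x : Pt) (c i : Fin 3) :
    nabla G T x ![c, i] = pd c (fun y => T y ![i]) x
      - ∑ m, christoffel G m c i x * T x ![m] := by
  have e : ∀ m, Function.update ![i] 0 m = ![m] := fun m => by ext p; fin_cases p; simp
  have t : Fin.tail ![c, i] = ![i] := by ext p; fin_cases p; rfl
  simp only [nabla, t, Fin.sum_univ_one, e]
  simp

theorem nabla_two (T : Tensor 2) (x : Pt) (c i j : Fin 3) :
    nabla G T x ![c, i, j] = pd c (fun y => T y ![i, j]) x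
      - ∑ m, christoffel G m c i x * T x ![m, j] - ∑ m, christoffel G m c j x * T x ![i, m] := by
  have t : Fin.tail ![c, i, j] = ![i, j] := by ext p; fin_cases p <;> rfl
  have e0 : ∀ m, Function.update ![i, j] 0 m = ![m, j] := fun m => by
    ext p; fin_cases p <;> simp
  have e1 : ∀ m, Function.update ![i, j] 1 m = ![i, m] := fun m => by
    ext p; fin_cases p <;> simp
  simp only [nabla, t, Fin.sum_univ_two, e0, e1]
  simp [sub_sub]

theorem sym_two (T : Tensor 2) (x : Pt) (i j : Fin 3) :
    sym T x ![i, j] = (1 / 2 : ℝ) * (T x ![i, j] + T x ![j, i]) := by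
  have hu : (Finset.univ : Finset (Equiv.Perm (Fin 2))) = {1, Equiv.swap 0 1} := by decide
  have e : (![i, j] ∘ (Equiv.swap 0 1 : Equiv.Perm (Fin 2))) = ![j, i] := by
    ext p; fin_cases p <;> simp
  rw [sym, hu, Finset.sum_pair (by decide)]
  simp [e, Nat.factorial]

theorem sym_three (T : Tensor 3) (x : Pt) (i j k : Fin 3) :
    sym T x ![i, j, k] = (1 / 6 : ℝ) * (T x ![i, j, k] + T x ![j, i, k] + T x ![k, j, i]
      + T x ![i, k, j] + T x ![j, k, i] + T x ![k, i, j]) := by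
  have hu : (Finset.univ : Finset (Equiv.Perm (Fin 3))) = {1, Equiv.swap 0 1, Equiv.swap 0 2,
    Equiv.swap 1 2, Equiv.swap 0 1 * Equiv.swap 1 2, Equiv.swap 1 2 * Equiv.swap 0 1} := by decide
  have e1 : (![i, j, k] ∘ (Equiv.swap 0 1 : Equiv.Perm (Fin 3))) = ![j, i, k] := by
    ext p; fin_cases p <;> rfl
  have e2 : (![i, j, k] ∘ (Equiv.swap 0 2 : Equiv.Perm (Fin 3))) = ![k, j, i] := by
    ext p; fin_cases p <;> rfl
  have e3 : (![i, j, k] ∘ (Equiv.swap 1 2 : Equiv.Perm (Fin 3))) = ![i, k, j] := by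
    ext p; fin_cases p <;> rfl
  have e4 : (![i, j, k] ∘ (Equiv.swap 0 1 * Equiv.swap 1 2 : Equiv.Perm (Fin 3)))
      = ![j, k, i] := by
    ext p; fin_cases p <;> rfl
  have e5 : (![i, j, k] ∘ (Equiv.swap 1 2 * Equiv.swap 0 1 : Equiv.Perm (Fin 3)))
      = ![k, i, j] := by
    ext p; fin_cases p <;> rfl
  have e0 : (![i, j, k] ∘ (1 : Equiv.Perm (Fin 3))) = ![i, j, k] := rfl
  rw [sym, hu, Finset.sum_insert (by decide), Finset.sum_insert (by decide),
    Finset.sum_insert (by decide), Finset.sum_insert (by decide), Finset.sum_pair (by decide),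
    e0, e1, e2, e3, e4, e5]
  norm_num [Nat.factorial]
  ring

end Components

/-! ### Full contractions -/

/-- The family behaves as a covariant tensor under changes of coordinates. -/
def IsNaturalTensor {k : ℕ} (T : MetricField → (Pt → ℝ) → Tensor k) : Prop :=
  ∀ ⦃U V : Set Pt⦄ ⦃G : MetricField⦄ ⦃f : Pt → ℝ⦄ ⦃Φ : Pt → Pt⦄, IsCoordChange U V G f Φ →
    ∀ x ∈ V, ∀ i, T (pullback Φ G) (f ∘ Φ) x i =
      ∑ d, (∏ p, jacobian Φ x (d p) (i p)) * T G f (Φ x) d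

theorem IsNatural₁.tensor {T : MetricField → (Pt → ℝ) → Tensor 1}
    (h : IsNatural₁ fun i G f x => T G f x ![i]) : IsNaturalTensor T := by
  intro U V G f Φ hΦ x hx a
  have := h hΦ x hx (a 0)
  simp only [vec_one_eta] at this
  rw [this, sum_vec_one]
  simp

theorem IsNatural₂.tensor {T : MetricField → (Pt → ℝ) → Tensor 2}
    (h : IsNatural₂ fun i j G f x => T G f x ![i, j]) : IsNaturalTensor T := by
  intro U V G f Φ hΦ x hx a
  have := h hΦ x hx (a 0) (a 1)
  simp only [vec_two_eta] at this
  rw [this, sum_vec_two]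
  simp [Fin.prod_univ_two]

theorem IsNatural₃.tensor {T : MetricField → (Pt → ℝ) → Tensor 3}
    (h : IsNatural₃ fun i j k G f x => T G f x ![i, j, k]) : IsNaturalTensor T := by
  intro U V G f Φ hΦ x hx a
  have := h hΦ x hx (a 0) (a 1) (a 2)
  simp only [vec_three_eta] at this
  rw [this, sum_vec_three]
  simp [Fin.prod_univ_three]

/-- A product of sums over p is a sum over multi-indices of products, so the rank-one relation A P'
Aᵀ = P passes to the tensor powers in every rank. -/
theorem contract_tensor {k : ℕ} {A P P' : Fin 3 → Fin 3 → ℝ}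
    (hP : ∀ a b, ∑ i, ∑ j, A a i * P' i j * A b j = P a b) (T S : (Fin k → Fin 3) → ℝ) :
    ∑ i : Fin k → Fin 3, (∑ l : Fin k → Fin 3, (∏ p, P' (i p) (l p)) * ∑ d : Fin k → Fin 3,
        (∏ p, A (d p) (l p)) * T d) * (∑ e : Fin k → Fin 3, (∏ p, A (e p) (i p)) * S e)
      = ∑ e : Fin k → Fin 3, (∑ d : Fin k → Fin 3, (∏ p, P (e p) (d p)) * T d) * S e := by
  have key : ∀ e d : Fin k → Fin 3, ∏ p, P (e p) (d p) =
      ∑ i : Fin k → Fin 3, ∑ l : Fin k → Fin 3,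
        (∏ p, A (e p) (i p)) * (∏ p, P' (i p) (l p)) * ∏ p, A (d p) (l p) := by
    intro e d
    simp only [← hP, Finset.prod_univ_sum, Fintype.piFinset_univ, Finset.prod_mul_distrib]
  simp only [key, Finset.sum_mul, Finset.mul_sum]
  rw [Finset.sum_comm]
  refine Finset.sum_congr rfl fun e _ => ?_
  conv_rhs => rw [Finset.sum_comm]
  refine Finset.sum_congr rfl fun i _ => ?_
  rw [Finset.sum_comm]
  refine Finset.sum_congr rfl fun d _ => Finset.sum_congr rfl fun l _ => by ring

theorem IsNaturalTensor.contract {k : ℕ} {T S : MetricField → (Pt → ℝ) → Tensor k}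
    (hT : IsNaturalTensor T) (hS : IsNaturalTensor S) :
    IsNatural fun G f x => ∑ i, up G (T G f) x i * S G f x i := by
  intro U V G f Φ h x hx
  simp only [up, hT h x hx, hS h x hx]
  exact contract_tensor (h.ginv_pullback hx) _ _

/-! ### The jet of the function -/

/-- The components `f_i`. -/
def jet₁ (i : Fin 3) : Quantity := fun G f x => covD G f 1 x ![i]

/-- The components `f_{ij}`. -/
def jet₂ (i j : Fin 3) : Quantity := fun G f x => covD G f 2 x ![i, j]

theorem jet₁_eq (i : Fin 3) (G : MetricField) (f : Pt → ℝ) : jet₁ i G f = pd i f := by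
  funext x
  simp [jet₁, covD, nabla]

theorem jet₂_eq : jet₂ = cov₁ jet₁ := by
  funext i j G f x
  exact nabla_one _ _ _ _

/-- The base of the induction on expressions: the covariant derivative of a jet variable is the jet
variable of the next order. -/
theorem isTensor₁_jet₁ : IsTensor₁ jet₁ where
  smooth i _ _ _ h := by
    rw [jet₁_eq]
    exact contDiffOn_pd h.isOpen h.smooth_fun i
  natural _ _ _ _ _ h x hx i := by
    simp only [jet₁_eq]
    exact h.pd_comp hx h.pair.smooth_fun i
  poly i := isPoly_covD 1 _
  poly_cov c i := (isPoly_covD 2 ![c, i]).congr fun _ _ _ => (nabla_one _ _ _ _).symm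

theorem isTensor₂_jet₂ : IsTensor₂ jet₂ where
  smooth i j := by
    rw [jet₂_eq]
    exact isSmooth_cov₁ isTensor₁_jet₁.smooth i j
  natural := by
    rw [jet₂_eq]
    exact isTensor₁_jet₁.natural.cov isTensor₁_jet₁.smooth
  poly i j := isPoly_covD 2 _
  poly_cov c i j := (isPoly_covD 3 ![c, i, j]).congr fun _ _ _ => (nabla_two _ _ _ _ _).symm

/-! ### The second-order quantities -/

theorem isTensor₀_lap : IsTensor₀ lap := isTensor₂_jet₂.trace

theorem hessGrad_eq (G : MetricField) (f : Pt → ℝ) (x : Pt) (i : Fin 3) :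
    hessGrad G f x i = apply₂ jet₂ jet₁ i G f x := by
  simp only [hessGrad, up_one, apply₂, Finset.mul_sum]
  exact Finset.sum_congr rfl fun j _ => Finset.sum_congr rfl fun k _ => by
    simp only [jet₁, jet₂]; ring

theorem isTensor₁_hessGrad : IsTensor₁ fun i G f x => hessGrad G f x i := by
  simp only [hessGrad_eq]
  exact isTensor₂_jet₂.apply isTensor₁_jet₁

theorem isTensor₀_J : IsTensor₀ J := by
  refine (isTensor₁_jet₁.inner isTensor₁_jet₁).congr fun _ x _ => ?_
  simp only [J, up_one, inner₁, Finset.sum_mul]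
  exact Finset.sum_congr rfl fun j _ => Finset.sum_congr rfl fun k _ => by
    simp only [jet₁]; ring

theorem isTensor₀_hessGradGrad : IsTensor₀ hessGradGrad := by
  refine (isTensor₁_jet₁.inner isTensor₁_hessGrad).congr fun h x hx => ?_
  have hs := h.ginv_symm hx
  simp only [hessGradGrad, hessGrad, up_one, up_two, inner₁, Fin.sum_univ_three, jet₁,
    hs 1 0, hs 2 0, hs 2 1]
  ring

theorem isTensor₀_Z : IsTensor₀ Z :=
  isTensor₀_hessGradGrad.add (isTensor₀_J.mul isTensor₀_lap)

theorem isTensor₀_X : IsTensor₀ X := by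
  -- With h_i = f_i^j f_j and H = ∇∇f, one has X = 2|h|² - J|H|² + J(tr H)².
  have hh := isTensor₁_hessGrad.inner isTensor₁_hessGrad
  have h2 := (isTensor₂_jet₂.comp isTensor₂_jet₂).trace
  refine ((((IsTensor₀.const 2).mul hh).add ((IsTensor₀.const (-1)).mul (isTensor₀_J.mul h2))).add
    (isTensor₀_J.mul (isTensor₀_lap.mul isTensor₀_lap))).congr fun {U G f} h x hx => ?_
  have hs := h.ginv_symm hx
  have e1 : ∑ i, ∑ k, hessGrad G f x i * up G (covD G f 2) x ![i, k] * covD G f 1 x ![k]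
      = inner₁ (fun i G f x => hessGrad G f x i) (fun i G f x => hessGrad G f x i) G f x := by
    simp only [inner₁]
    generalize hu : hessGrad G f x = u
    rw [← hu]
    simp only [hessGrad, up_one, up_two, Fin.sum_univ_three, hs 1 0, hs 2 0, hs 2 1]
    ring
  have e2 : ∑ j, ∑ k, up G (covD G f 2) x ![j, k] * covD G f 2 x ![j, k]
      = trace₂ (comp₂ jet₂ jet₂) G f x := by
    simp only [trace₂, comp₂, up_two, Fin.sum_univ_three, jet₂]
    ring
  simp only [X, e1, e2]
  ring

/-- The part of `φ` without the metric. -/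
def phiCore (i j : Fin 3) : Quantity := fun G f x =>
  J G f x * jet₂ i j G f x + -1 * (jet₁ i G f x * hessGrad G f x j
    + hessGrad G f x i * jet₁ j G f x)

/-- The coefficient of the metric in `φ`. -/
def phiTrace : Quantity := fun G f x =>
  -1 / 3 * (J G f x * lap G f x) + 2 / 3 * hessGradGrad G f x

theorem isTensor₂_phiCore : IsTensor₂ phiCore :=
  (isTensor₀_J.smul isTensor₂_jet₂).add ((IsTensor₀.const (-1)).smul
    ((isTensor₁_jet₁.outer isTensor₁_hessGrad).add (isTensor₁_hessGrad.outer isTensor₁_jet₁)))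

theorem isTensor₀_phiTrace : IsTensor₀ phiTrace :=
  ((IsTensor₀.const (-1 / 3)).mul (isTensor₀_J.mul isTensor₀_lap)).add
    ((IsTensor₀.const (2 / 3)).mul isTensor₀_hessGradGrad)

/-- The components `φ_{ij}`. -/
def phi₂ (i j : Fin 3) : Quantity := fun G f x => phi G f x ![i, j]

/-- Isolates the one place where φ involves a lowered metric component. -/
theorem phi₂_eq (i j : Fin 3) :
    phi₂ i j = fun G f x => phiCore i j G f x + phiTrace G f x * G x i j := by
  funext G f x
  simp only [phi₂, phi, sym_two, phiCore, phiTrace, jet₁, jet₂]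
  simp
  ring

theorem isSmooth_phi₂ (i j : Fin 3) : IsSmooth (phi₂ i j) := by
  rw [phi₂_eq]
  exact (isTensor₂_phiCore.smooth i j).add (isTensor₀_phiTrace.smooth.mul (isSmooth_metric i j))

theorem isNatural₂_phi₂ : IsNatural₂ phi₂ := by
  intro U V G f Φ h x hx i j
  simp only [phi₂_eq, isTensor₂_phiCore.natural h x hx, isTensor₀_phiTrace.natural h x hx,
    isNatural₂_metric h x hx i j, mul_add, Finset.sum_add_distrib, Finset.mul_sum]
  congr 1
  exact Finset.sum_congr rfl fun a _ => Finset.sum_congr rfl fun b _ => by ring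

/-- Because ∇g = 0, only the coefficient of g is differentiated. -/
theorem cov₂_phi₂ {U : Set Pt} {G : MetricField} {f : Pt → ℝ} (h : IsMetricPair G f U)
    {x : Pt} (hx : x ∈ U) (c i j : Fin 3) :
    cov₂ phi₂ c i j G f x = cov₂ phiCore c i j G f x + pd c (phiTrace G f) x * G x i j := by
  have d1 := (isTensor₂_phiCore.smooth i j).differentiableAt h hx
  have d2 := isTensor₀_phiTrace.smooth.differentiableAt h hx
  have d3 : DifferentiableAt ℝ (fun x => G x i j) x := (isSmooth_metric i j).differentiableAt h hx
  have d4 : DifferentiableAt ℝ (fun x => phiTrace G f x * G x i j) x := d2.mul d3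
  have hg := cov₂_metric h hx c i j
  simp only [cov₂] at hg
  simp only [cov₂, phi₂_eq, pd_add d1 d4, pd_mul d2 d3, Fin.sum_univ_three] at hg ⊢
  linear_combination phiTrace G f x * hg

/-! ### The third-order quantities -/

theorem nabla_phi (G : MetricField) (f : Pt → ℝ) (x : Pt) (c i j : Fin 3) :
    nabla G (phi G f) x ![c, i, j] = cov₂ phi₂ c i j G f x :=
  nabla_two _ _ _ _ _

theorem isNatural₃_nabla_phi : IsNatural₃ (cov₂ phi₂) :=
  isNatural₂_phi₂.cov isSmooth_phi₂

section Naturality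

theorem IsNatural₁.comb {p q : Quantity} {v w : Fin 3 → Quantity} (hp : IsNatural p)
    (hq : IsNatural q) (hv : IsNatural₁ v) (hw : IsNatural₁ w) :
    IsNatural₁ fun i G f x => p G f x * v i G f x - q G f x * w i G f x := by
  intro U V G f Φ h x hx i
  simp only [hp h x hx, hq h x hx, hv h x hx, hw h x hx, Fin.sum_univ_three]
  ring

theorem isNatural₁_sigma : IsNatural₁ fun i G f x => sigma G f x ![i] :=
  IsNatural₁.comb isTensor₀_J.natural ((IsTensor₀.const 2).mul isTensor₀_Z).natural
    (isTensor₀_Z.natural.pd isTensor₀_Z.smooth) (isTensor₀_J.natural.pd isTensor₀_J.smooth)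

theorem isNatural₁_tau : IsNatural₁ fun i G f x => tau G f x ![i] :=
  IsNatural₁.comb isTensor₀_J.natural ((IsTensor₀.const 3).mul isTensor₀_X).natural
    (isTensor₀_X.natural.pd isTensor₀_X.smooth) (isTensor₀_J.natural.pd isTensor₀_J.smooth)

theorem isNatural₁_divPhi : IsNatural₁ fun k G f x => divPhi G f x k := by
  intro U V G f Φ h x hx k
  simp only [divPhi, nabla_phi]
  have e : ∀ l m, cov₂ phi₂ l k m (pullback Φ G) (f ∘ Φ) x = ∑ a, ∑ b,
      jacobian Φ x a l * jacobian Φ x b m *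
        ∑ d, jacobian Φ x d k * cov₂ phi₂ a d b G f (Φ x) := fun l m => by
    rw [isNatural₃_nabla_phi h x hx]
    refine Finset.sum_congr rfl fun a _ => ?_
    rw [Finset.sum_comm]
    refine Finset.sum_congr rfl fun b _ => ?_
    rw [Finset.mul_sum]
    exact Finset.sum_congr rfl fun d _ => by ring
  simp only [e]
  rw [contract_trace (h.ginv_pullback hx)]
  simp only [Fin.sum_univ_three]
  ring

theorem phiGradJ_eq (k : Fin 3) (G : MetricField) (f : Pt → ℝ) (x : Pt) :
    phiGradJ G f x k = apply₂ phi₂ (fun i G f => pd i (J G f)) k G f x := by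
  simp only [phiGradJ, up_one, apply₂, Finset.mul_sum]
  exact Finset.sum_congr rfl fun j _ => Finset.sum_congr rfl fun l _ => by
    simp only [phi₂, grad]
    simp
    ring

theorem isNatural₁_phiGradJ : IsNatural₁ fun k G f x => phiGradJ G f x k := by
  simp only [phiGradJ_eq]
  exact isNatural₂_phi₂.apply (isTensor₀_J.natural.pd isTensor₀_J.smooth)

theorem isNatural₁_lam : IsNatural₁ fun i G f x => lam G f x ![i] := by
  have h := IsNatural₁.comb ((IsTensor₀.const 2).mul isTensor₀_J).natural
    (IsTensor₀.const 1).natural isNatural₁_divPhi isNatural₁_phiGradJ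
  simpa [lam] using h

/-- The unsymmetrised expression is already tensorial, and symmetrisation preserves the law because
the Jacobian factors are permuted along with the indices. -/
theorem isNatural₃_rho : IsNatural₃ fun i j k G f x => rho G f x ![i, j, k] := by
  have key : IsNatural₃ fun i j k G f x => J G f x * cov₂ phi₂ i j k G f x
      - 3 * phi₂ i j G f x * pd k (J G f) x
      - (2 / 5) * J G f x * G x i j * divPhi G f x k
      + (6 / 5) * G x i j * phiGradJ G f x k := by
    intro U V G f Φ h x hx i j k
    simp only [isTensor₀_J.natural h x hx, isNatural₃_nabla_phi h x hx, isNatural₂_phi₂ h x hx,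
      isNatural₁_divPhi h x hx, isNatural₁_phiGradJ h x hx,
      isTensor₀_J.natural.pd isTensor₀_J.smooth h x hx, isNatural₂_metric h x hx]
    generalize phi₂ = p
    simp only [Fin.sum_univ_three]
    ring
  intro U V G f Φ h x hx i j k
  have := key h x hx
  simp only [rho, sym_three, nabla_phi, grad]
  simp only [phi₂] at this
  simp [this]
  simp only [Fin.sum_univ_three]
  ring

theorem IsNatural₁.pair {S T : MetricField → (Pt → ℝ) → Tensor 1}
    (hS : IsNatural₁ fun i G f x => S G f x ![i]) (hT : IsNatural₁ fun i G f x => T G f x ![i]) :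
    IsNatural fun G f => pair G (S G f) (T G f) := by
  have h := hS.tensor.contract hT.tensor
  simp only [sum_vec_one] at h
  exact h

theorem IsNatural₁.phiPair {S T : MetricField → (Pt → ℝ) → Tensor 1}
    (hS : IsNatural₁ fun i G f x => S G f x ![i]) (hT : IsNatural₁ fun i G f x => T G f x ![i]) :
    IsNatural fun G f => phiPair G f (S G f) (T G f) := by
  have h2 : IsNatural₂ fun i j G f x => S G f x ![i] * T G f x ![j] := by
    intro U V G f Φ h x hx i j
    simp only [hS h x hx, hT h x hx, Fin.sum_univ_three]
    ring
  have h := isNatural₂_phi₂.tensor.contract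
    (IsNatural₂.tensor (T := fun G f x a => S G f x ![a 0] * T G f x ![a 1]) h2)
  simp only [sum_vec_two] at h
  have e : (fun G f => ConfInv.phiPair G f (S G f) (T G f)) = fun G f x => ∑ i, ∑ j,
      up G (phi G f) x ![i, j] * (S G f x ![i] * T G f x ![j]) := by
    funext G f x
    exact Finset.sum_congr rfl fun i _ => Finset.sum_congr rfl fun j _ => by ring
  rw [e]
  exact h

theorem isNatural_F : IsNatural F := by
  have h3 : IsNatural₃ fun i j k G f x => phi₂ i j G f x * lam G f x ![k] := by
    intro U V G f Φ h x hx i j k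
    simp only [isNatural₂_phi₂ h x hx, isNatural₁_lam h x hx, Fin.sum_univ_three]
    ring
  have h := isNatural₃_rho.tensor.contract
    (IsNatural₃.tensor (T := fun G f x a => phi₂ (a 0) (a 1) G f x * lam G f x ![a 2]) h3)
  simp only [sum_vec_three] at h
  have e : F = fun G f x => ∑ i, ∑ j, ∑ k, up G (rho G f) x ![i, j, k] *
      (phi₂ i j G f x * lam G f x ![k]) := by
    funext G f x
    exact Finset.sum_congr rfl fun i _ => Finset.sum_congr rfl fun j _ =>
      Finset.sum_congr rfl fun k _ => by simp only [phi₂]; ring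
  rw [e]
  exact h

theorem isNatural_N : IsNatural N := by
  have h3 : IsNatural₃ fun i j k G f x => phi₂ j k G f x * sigma G f x ![i] := by
    intro U V G f Φ h x hx i j k
    simp only [isNatural₂_phi₂ h x hx, isNatural₁_sigma h x hx, Fin.sum_univ_three]
    ring
  have h := isNatural₃_rho.tensor.contract
    (IsNatural₃.tensor (T := fun G f x a => phi₂ (a 1) (a 2) G f x * sigma G f x ![a 0]) h3)
  simp only [sum_vec_three] at h
  have e : N = fun G f x => ∑ i, ∑ j, ∑ k, up G (rho G f) x ![i, j, k] *
      (phi₂ j k G f x * sigma G f x ![i]) := by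
    funext G f x
    exact Finset.sum_congr rfl fun i _ => Finset.sum_congr rfl fun j _ =>
      Finset.sum_congr rfl fun k _ => by simp only [phi₂]; ring
  rw [e]
  exact h

/-- The partial contraction ρ_{ij}^l φ_{kl} is first recognised as a covariant tensor of rank three;
W is then its full contraction with ρ. -/
theorem isNatural_W : IsNatural W := by
  have h3 : IsNatural₃ fun i j k G f x => ∑ m, ∑ l, ginv G x m l * rho G f x ![i, j, m] *
      phi₂ k l G f x := by
    intro U V G f Φ h x hx i j k
    have e1 : ∀ m, rho (pullback Φ G) (f ∘ Φ) x ![i, j, m] = ∑ c, jacobian Φ x c m *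
        ∑ a, ∑ b, jacobian Φ x a i * jacobian Φ x b j * rho G f (Φ x) ![a, b, c] := by
      intro m
      refine (isNatural₃_rho h x hx i j m).trans ?_
      simp only [Fin.sum_univ_three]
      ring
    have e2 : ∀ l, phi₂ k l (pullback Φ G) (f ∘ Φ) x = ∑ c, jacobian Φ x c l *
        ∑ a, jacobian Φ x a k * phi₂ a c G f (Φ x) := by
      intro l
      rw [isNatural₂_phi₂ h x hx k l]
      simp only [Fin.sum_univ_three]
      ring
    simp only [e1, e2]
    rw [contract_pair (h.ginv_pullback hx)]
    simp only [Finset.mul_sum, Finset.sum_mul]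
    generalize jacobian Φ x = A
    generalize phi₂ = p
    generalize rho G f (Φ x) = r
    simp only [Fin.sum_univ_three]
    ring
  have h := isNatural₃_rho.tensor.contract
    (IsNatural₃.tensor (T := fun G f x a => ∑ m, ∑ l, ginv G x m l *
      rho G f x ![a 0, a 1, m] * phi₂ (a 2) l G f x) h3)
  simp only [sum_vec_three] at h
  have e : W = fun G f x => ∑ i, ∑ j, ∑ k, up G (rho G f) x ![i, j, k] *
      (∑ m, ∑ l, ginv G x m l * rho G f x ![i, j, m] * phi₂ k l G f x) := by
    funext G f x
    refine Finset.sum_congr rfl fun i _ => Finset.sum_congr rfl fun j _ =>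
      Finset.sum_congr rfl fun k _ => ?_
    rw [Finset.sum_comm, Finset.mul_sum]
    refine Finset.sum_congr rfl fun l _ => ?_
    simp only [Finset.mul_sum, Finset.sum_mul, phi₂]
    exact Finset.sum_congr rfl fun m _ => by ring
  rw [e]
  exact h

end Naturality

/-! ### Polynomial expressions for the third-order quantities -/

section Polynomiality

/-- `φ^{ij}` without lowered metric components. -/
def phiUp (i j : Fin 3) : Quantity := fun G f x =>
  ∑ a, ∑ b, ginv G x i a * ginv G x j b * phiCore a b G f x + phiTrace G f x * ginv G x i j

/-- `φ_k^m` without lowered metric components. -/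
def phiMixed (k m : Fin 3) : Quantity := fun G f x =>
  ∑ l, ginv G x m l * phiCore k l G f x + phiTrace G f x * if m = k then 1 else 0

/-- `∇^l φ_{kl}` without lowered metric components. -/
def divPhiPoly (k : Fin 3) : Quantity := fun G f x =>
  ∑ l, ∑ m, ginv G x l m * cov₂ phiCore l k m G f x + pd k (phiTrace G f) x

/-- `φ_{kl} ∇^l J` without lowered metric components. -/
def phiGradJPoly (k : Fin 3) : Quantity := fun G f x =>
  ∑ m, phiMixed k m G f x * pd m (J G f) x

/-- The part of `ρ` without the metric, before symmetrisation. -/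
def rhoCore (a b c : Fin 3) : Quantity := fun G f x =>
  J G f x * cov₂ phiCore a b c G f x - 3 * phiCore a b G f x * pd c (J G f) x

/-- The part of `ρ` without the metric. -/
def rhoSym (a b c : Fin 3) : Quantity := fun G f x =>
  (1 / 6 : ℝ) * (rhoCore a b c G f x + rhoCore b a c G f x + rhoCore c b a G f x
    + rhoCore a c b G f x + rhoCore b c a G f x + rhoCore c a b G f x)

/-- The covector multiplying the metric in `ρ`. -/
def rhoTrace (c : Fin 3) : Quantity := fun G f x =>
  J G f x * pd c (phiTrace G f) x - 3 * phiTrace G f x * pd c (J G f) x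
    - (2 / 5) * J G f x * divPhiPoly c G f x + (6 / 5) * phiGradJPoly c G f x

/-- The raised `rhoTrace`. -/
def rhoTraceUp (i : Fin 3) : Quantity := fun G f x => ∑ a, ginv G x i a * rhoTrace a G f x

/-- `ρ^{ijk}` without lowered metric components. -/
def rhoUp (i j k : Fin 3) : Quantity := fun G f x =>
  ∑ a, ∑ b, ∑ c, ginv G x i a * ginv G x j b * ginv G x k c * rhoSym a b c G f x
    + (1 / 3 : ℝ) * (ginv G x i j * rhoTraceUp k G f x + ginv G x j k * rhoTraceUp i G f x
      + ginv G x i k * rhoTraceUp j G f x)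

/-- `ρ_m^{jk}` without lowered metric components. -/
def rhoMixed (m j k : Fin 3) : Quantity := fun G f x =>
  ∑ b, ∑ c, ginv G x j b * ginv G x k c * rhoSym m b c G f x
    + (1 / 3 : ℝ) * ((if m = j then 1 else 0) * rhoTraceUp k G f x
      + ginv G x j k * rhoTrace m G f x + (if m = k then 1 else 0) * rhoTraceUp j G f x)

theorem isPoly_phiUp (i j : Fin 3) : IsPoly (phiUp i j) :=
  (IsPoly.sum fun a => .sum fun b => ((isPoly_ginv i a).mul (isPoly_ginv j b)).mul
    (isTensor₂_phiCore.poly a b)).add (isTensor₀_phiTrace.poly.mul (isPoly_ginv i j))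

theorem isPoly_phiMixed (k m : Fin 3) : IsPoly (phiMixed k m) :=
  (IsPoly.sum fun l => (isPoly_ginv m l).mul (isTensor₂_phiCore.poly k l)).add
    (isTensor₀_phiTrace.poly.mul (.const _))

theorem isPoly_divPhiPoly (k : Fin 3) : IsPoly (divPhiPoly k) :=
  (IsPoly.sum fun l => .sum fun m => (isPoly_ginv l m).mul
    (isTensor₂_phiCore.poly_cov l k m)).add (isTensor₀_phiTrace.poly_cov k)

theorem isPoly_phiGradJPoly (k : Fin 3) : IsPoly (phiGradJPoly k) :=
  .sum fun m => (isPoly_phiMixed k m).mul (isTensor₀_J.poly_cov m)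

theorem isPoly_rhoCore (a b c : Fin 3) : IsPoly (rhoCore a b c) :=
  (isTensor₀_J.poly.mul (isTensor₂_phiCore.poly_cov a b c)).sub
    (((IsPoly.const 3).mul (isTensor₂_phiCore.poly a b)).mul (isTensor₀_J.poly_cov c))

theorem isPoly_rhoSym (a b c : Fin 3) : IsPoly (rhoSym a b c) :=
  (IsPoly.const _).mul ((((((isPoly_rhoCore a b c).add (isPoly_rhoCore b a c)).add
    (isPoly_rhoCore c b a)).add (isPoly_rhoCore a c b)).add (isPoly_rhoCore b c a)).add
    (isPoly_rhoCore c a b))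

theorem isPoly_rhoTrace (c : Fin 3) : IsPoly (rhoTrace c) :=
  (((isTensor₀_J.poly.mul (isTensor₀_phiTrace.poly_cov c)).sub
    (((IsPoly.const 3).mul isTensor₀_phiTrace.poly).mul (isTensor₀_J.poly_cov c))).sub
    (((IsPoly.const (2 / 5)).mul isTensor₀_J.poly).mul (isPoly_divPhiPoly c))).add
    ((IsPoly.const (6 / 5)).mul (isPoly_phiGradJPoly c))

theorem isPoly_rhoTraceUp (i : Fin 3) : IsPoly (rhoTraceUp i) :=
  .sum fun a => (isPoly_ginv i a).mul (isPoly_rhoTrace a)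

theorem isPoly_rhoUp (i j k : Fin 3) : IsPoly (rhoUp i j k) :=
  (IsPoly.sum fun a => .sum fun b => .sum fun c => (((isPoly_ginv i a).mul (isPoly_ginv j b)).mul
    (isPoly_ginv k c)).mul (isPoly_rhoSym a b c)).add ((IsPoly.const _).mul
    ((((isPoly_ginv i j).mul (isPoly_rhoTraceUp k)).add
      ((isPoly_ginv j k).mul (isPoly_rhoTraceUp i))).add
      ((isPoly_ginv i k).mul (isPoly_rhoTraceUp j))))

theorem isPoly_rhoMixed (m j k : Fin 3) : IsPoly (rhoMixed m j k) :=
  (IsPoly.sum fun b => .sum fun c => ((isPoly_ginv j b).mul (isPoly_ginv k c)).mul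
    (isPoly_rhoSym m b c)).add ((IsPoly.const _).mul
    ((((IsPoly.const _).mul (isPoly_rhoTraceUp k)).add
      ((isPoly_ginv j k).mul (isPoly_rhoTrace m))).add
      ((IsPoly.const _).mul (isPoly_rhoTraceUp j))))

variable {U : Set Pt} {G : MetricField} {f : Pt → ℝ} {x : Pt}

theorem IsMetricPair.sum_ginv_ginv_metric (h : IsMetricPair G f U) (hx : x ∈ U) (i j : Fin 3) :
    ∑ a, ∑ b, ginv G x i a * ginv G x j b * G x a b = ginv G x i j := by
  rw [Finset.sum_comm]
  simp only [mul_right_comm, ← Finset.sum_mul, h.ginv_mul hx]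
  simp [h.ginv_symm hx j i]

theorem up_phi_eq (h : IsMetricPair G f U) (hx : x ∈ U) (i j : Fin 3) :
    up G (phi G f) x ![i, j] = phiUp i j G f x := by
  have e : ∀ a b, phi G f x ![a, b] = phiCore a b G f x + phiTrace G f x * G x a b :=
    fun a b => congrFun (congrFun (congrFun (phi₂_eq a b) G) f) x
  rw [phiUp, ← h.sum_ginv_ginv_metric hx i j]
  simp only [up_two, e, mul_add, Finset.sum_add_distrib, Finset.mul_sum]
  congr 1
  exact Finset.sum_congr rfl fun a _ => Finset.sum_congr rfl fun b _ => by ring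

theorem phiMixed_eq (h : IsMetricPair G f U) (hx : x ∈ U) (k m : Fin 3) :
    ∑ l, ginv G x m l * phi G f x ![k, l] = phiMixed k m G f x := by
  have e : ∀ a b, phi G f x ![a, b] = phiCore a b G f x + phiTrace G f x * G x a b :=
    fun a b => congrFun (congrFun (congrFun (phi₂_eq a b) G) f) x
  simp only [e, phiMixed, ← h.ginv_mul hx, mul_add, Finset.sum_add_distrib, Finset.mul_sum]
  congr 1
  exact Finset.sum_congr rfl fun a _ => by rw [h.symm hx k a]; ring

/-- The part of φ proportional to g has as divergence the gradient of its coefficient. -/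
theorem divPhi_eq (h : IsMetricPair G f U) (hx : x ∈ U) (k : Fin 3) :
    divPhi G f x k = divPhiPoly k G f x := by
  simp only [divPhi, nabla_phi, cov₂_phi₂ h hx, divPhiPoly, mul_add, Finset.sum_add_distrib]
  congr 1
  have e : ∀ l, ∑ m, ginv G x l m * (pd l (phiTrace G f) x * G x k m)
      = pd l (phiTrace G f) x * ∑ m, ginv G x l m * G x m k := fun l => by
    rw [Finset.mul_sum]
    exact Finset.sum_congr rfl fun m _ => by rw [h.symm hx k m]; ring
  simp [e, h.ginv_mul hx]

theorem phiGradJ_poly (h : IsMetricPair G f U) (hx : x ∈ U) (k : Fin 3) :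
    phiGradJ G f x k = phiGradJPoly k G f x := by
  simp only [phiGradJPoly, ← phiMixed_eq h hx, phiGradJ_eq, apply₂, Finset.sum_mul]
  rw [Finset.sum_comm]
  refine Finset.sum_congr rfl fun m _ => Finset.sum_congr rfl fun l _ => ?_
  rw [h.ginv_symm hx l m, phi₂]

/-- All multiples of g, those coming from φ and ∇φ as well as the explicit trace terms, have the
form g_{ij}v_k with the single covector v = `rhoTrace`; symmetrising gives the three placements with
weight 1/3. -/
theorem rho_eq (h : IsMetricPair G f U) (hx : x ∈ U) (i j k : Fin 3) :
    rho G f x ![i, j, k] = rhoSym i j k G f x + (1 / 3 : ℝ) * (G x i j * rhoTrace k G f x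
      + G x j k * rhoTrace i G f x + G x i k * rhoTrace j G f x) := by
  have e : ∀ a b, phi G f x ![a, b] = phiCore a b G f x + phiTrace G f x * G x a b :=
    fun a b => congrFun (congrFun (congrFun (phi₂_eq a b) G) f) x
  simp only [rho, sym_three, nabla_phi, cov₂_phi₂ h hx, grad, e, divPhi_eq h hx,
    phiGradJ_poly h hx, rhoSym, rhoCore, rhoTrace]
  simp [h.symm hx j i, h.symm hx k i, h.symm hx k j]
  ring

theorem rho_swap (i j k : Fin 3) : rho G f x ![j, i, k] = rho G f x ![i, j, k] := by
  simp only [rho, sym_three]; ring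

theorem rho_rotate (i j k : Fin 3) : rho G f x ![j, k, i] = rho G f x ![i, j, k] := by
  simp only [rho, sym_three]; ring

theorem up_rho_swap (i j k : Fin 3) :
    up G (rho G f) x ![j, i, k] = up G (rho G f) x ![i, j, k] := by
  rw [up_three, up_three, Finset.sum_comm]
  exact Finset.sum_congr rfl fun a _ => Finset.sum_congr rfl fun b _ =>
    Finset.sum_congr rfl fun c _ => by rw [rho_swap]; ring

theorem up_rho_rotate (i j k : Fin 3) :
    up G (rho G f) x ![j, k, i] = up G (rho G f) x ![i, j, k] := by
  rw [up_three, up_three]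
  have e : ∀ b : Fin 3, ∑ c, ∑ a, ginv G x j b * ginv G x k c * ginv G x i a * rho G f x ![b, c, a]
      = ∑ a, ∑ c, ginv G x i a * ginv G x j b * ginv G x k c * rho G f x ![a, b, c] := fun b => by
    rw [Finset.sum_comm]
    exact Finset.sum_congr rfl fun a _ => Finset.sum_congr rfl fun c _ => by
      rw [rho_rotate]; ring
  rw [Finset.sum_congr rfl fun b _ => e b, Finset.sum_comm]

theorem up_rho_eq (h : IsMetricPair G f U) (hx : x ∈ U) (i j k : Fin 3) :
    up G (rho G f) x ![i, j, k] = rhoUp i j k G f x := by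
  rw [rhoUp, ← h.sum_ginv_ginv_metric hx i j, ← h.sum_ginv_ginv_metric hx j k,
    ← h.sum_ginv_ginv_metric hx i k]
  simp only [up_three, rho_eq h hx, rhoTraceUp]
  generalize rhoSym = q
  generalize rhoTrace = v
  simp only [Fin.sum_univ_three]
  ring

/-- Lowering one index of ρ^{ijk} turns the metric terms into δ or leaves a g^{jk}, so mixed
components are again polynomial. -/
theorem rhoMixed_eq (h : IsMetricPair G f U) (hx : x ∈ U) (m j k : Fin 3) :
    ∑ i, G x m i * up G (rho G f) x ![i, j, k] = rhoMixed m j k G f x := by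
  have e : ∑ i, G x m i * up G (rho G f) x ![i, j, k]
      = ∑ b, ∑ c, ginv G x j b * ginv G x k c * rho G f x ![m, b, c] := by
    calc _ = ∑ a, (∑ i, G x m i * ginv G x i a) *
          ∑ b, ∑ c, ginv G x j b * ginv G x k c * rho G f x ![a, b, c] := by
          simp only [Finset.sum_mul, up_three]
          rw [Finset.sum_comm]
          refine Finset.sum_congr rfl fun i _ => ?_
          rw [Finset.mul_sum]
          refine Finset.sum_congr rfl fun a _ => ?_
          simp only [Finset.mul_sum]
          exact Finset.sum_congr rfl fun b _ => Finset.sum_congr rfl fun c _ => by ring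
      _ = _ := by simp [h.mul_ginv hx]
  -- Each δ is written back as g⁻¹g, so that both sides become the same sum over components.
  have hd : ∀ j, (if m = j then (1 : ℝ) else 0) = ∑ b, ginv G x j b * G x m b := fun j => by
    rw [← h.mul_ginv hx]
    exact Finset.sum_congr rfl fun b _ => by rw [h.ginv_symm hx j b]; ring
  rw [e, rhoMixed, hd, hd, ← h.sum_ginv_ginv_metric hx j k]
  simp only [rho_eq h hx, rhoTraceUp]
  generalize rhoSym = q
  generalize rhoTrace = v
  simp only [Fin.sum_univ_three]
  ring

theorem isPoly_sigma (i : Fin 3) : IsPoly fun G f x => sigma G f x ![i] :=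
  (isTensor₀_J.poly.mul (isTensor₀_Z.poly_cov i)).sub
    (((IsPoly.const 2).mul isTensor₀_Z.poly).mul (isTensor₀_J.poly_cov i))

theorem isPoly_tau (i : Fin 3) : IsPoly fun G f x => tau G f x ![i] :=
  (isTensor₀_J.poly.mul (isTensor₀_X.poly_cov i)).sub
    (((IsPoly.const 3).mul isTensor₀_X.poly).mul (isTensor₀_J.poly_cov i))

theorem isPoly_lam (i : Fin 3) : IsPoly fun G f x => lam G f x ![i] :=
  ((((IsPoly.const 2).mul isTensor₀_J.poly).mul (isPoly_divPhiPoly i)).sub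
    (isPoly_phiGradJPoly i)).congr fun h x hx => by
      simp [lam, divPhi_eq h hx, phiGradJ_poly h hx]

theorem IsPoly.pair {S T : MetricField → (Pt → ℝ) → Tensor 1}
    (hS : ∀ i, IsPoly fun G f x => S G f x ![i]) (hT : ∀ i, IsPoly fun G f x => T G f x ![i]) :
    IsPoly fun G f => pair G (S G f) (T G f) := by
  refine (IsPoly.sum (s := Finset.univ) fun i => (IsPoly.sum (s := Finset.univ) fun j =>
    (isPoly_ginv i j).mul (hS j)).mul (hT i)).congr fun _ _ _ => ?_
  simp only [ConfInv.pair, up_one]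

theorem IsPoly.phiPair {S T : MetricField → (Pt → ℝ) → Tensor 1}
    (hS : ∀ i, IsPoly fun G f x => S G f x ![i]) (hT : ∀ i, IsPoly fun G f x => T G f x ![i]) :
    IsPoly fun G f => phiPair G f (S G f) (T G f) := by
  refine (IsPoly.sum (s := Finset.univ) fun i => IsPoly.sum (s := Finset.univ) fun j =>
    ((isPoly_phiUp i j).mul (hS i)).mul (hT j)).congr fun h x hx => ?_
  simp only [ConfInv.phiPair, up_phi_eq h hx]

/-- The metric-free part of φ contracts directly with ρ^{ijk}; the part proportional to g lowers an
index of ρ and yields the mixed trace ρ_j^{jk}. -/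
theorem isPoly_F : IsPoly F := by
  refine ((IsPoly.sum (s := Finset.univ) fun i => IsPoly.sum (s := Finset.univ) fun j =>
    IsPoly.sum (s := Finset.univ) fun k => ((isPoly_rhoUp i j k).mul
      (isTensor₂_phiCore.poly i j)).mul (isPoly_lam k)).add (isTensor₀_phiTrace.poly.mul
    (IsPoly.sum (s := Finset.univ) fun j => IsPoly.sum (s := Finset.univ) fun k =>
      (isPoly_rhoMixed j j k).mul (isPoly_lam k)))).congr fun {U G f} h x hx => ?_
  have e : ∀ a b, phi G f x ![a, b] = phiCore a b G f x + phiTrace G f x * G x a b :=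
    fun a b => congrFun (congrFun (congrFun (phi₂_eq a b) G) f) x
  have s := h.symm hx
  simp only [F, e, ← up_rho_eq h hx, ← rhoMixed_eq h hx]
  generalize up G (rho G f) x = r
  simp only [Fin.sum_univ_three, s 1 0, s 2 0, s 2 1]
  ring

theorem isPoly_N : IsPoly N := by
  refine ((IsPoly.sum (s := Finset.univ) fun i => IsPoly.sum (s := Finset.univ) fun j =>
    IsPoly.sum (s := Finset.univ) fun k => ((isPoly_sigma i).mul (isPoly_rhoUp i j k)).mul
      (isTensor₂_phiCore.poly j k)).add (isTensor₀_phiTrace.poly.mul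
    (IsPoly.sum (s := Finset.univ) fun i => IsPoly.sum (s := Finset.univ) fun k =>
      (isPoly_sigma i).mul (isPoly_rhoMixed k k i)))).congr fun {U G f} h x hx => ?_
  have e : ∀ a b, phi G f x ![a, b] = phiCore a b G f x + phiTrace G f x * G x a b :=
    fun a b => congrFun (congrFun (congrFun (phi₂_eq a b) G) f) x
  have r : ∀ i j k, up G (rho G f) x ![j, k, i] = up G (rho G f) x ![i, j, k] := up_rho_rotate
  have s := h.symm hx
  simp only [N, e, ← up_rho_eq h hx, ← rhoMixed_eq h hx, r]
  generalize up G (rho G f) x = r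
  simp only [Fin.sum_univ_three, s 1 0, s 2 0, s 2 1]
  ring

/-- `ρ^{ijk} ρ_{ijm}` without lowered metric components. -/
def rhoSquare (k m : Fin 3) : Quantity := fun G f x =>
  ∑ i, ∑ j, rhoUp i j k G f x * rhoSym i j m G f x + (1 / 3 : ℝ) *
    (∑ j, rhoMixed j j k G f x * rhoTrace m G f x + 2 * ∑ i, rhoMixed m i k G f x *
      rhoTrace i G f x)

theorem isPoly_rhoSquare (k m : Fin 3) : IsPoly (rhoSquare k m) :=
  (IsPoly.sum fun i => .sum fun j => (isPoly_rhoUp i j k).mul (isPoly_rhoSym i j m)).add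
    ((IsPoly.const _).mul ((IsPoly.sum fun j => (isPoly_rhoMixed j j k).mul
      (isPoly_rhoTrace m)).add ((IsPoly.const 2).mul (.sum fun i =>
        (isPoly_rhoMixed m i k).mul (isPoly_rhoTrace i)))))

/-- Inserting `rho_eq` for ρ_{ijm}, each g lowers an index of ρ^{ijk}. The terms with g_{jm} and
g_{im} agree by the symmetry of ρ, whence the factor 2 in `rhoSquare`. -/
theorem rhoSquare_eq (h : IsMetricPair G f U) (hx : x ∈ U) (k m : Fin 3) :
    ∑ i, ∑ j, up G (rho G f) x ![i, j, k] * rho G f x ![i, j, m] = rhoSquare k m G f x := by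
  have s := h.symm hx
  have r : ∀ i j k, up G (rho G f) x ![j, i, k] = up G (rho G f) x ![i, j, k] := up_rho_swap
  have t1 : ∑ i, ∑ j, up G (rho G f) x ![i, j, k] * (G x i j * rhoTrace m G f x)
      = ∑ j, rhoMixed j j k G f x * rhoTrace m G f x := by
    simp only [← rhoMixed_eq h hx, Finset.sum_mul]
    rw [Finset.sum_comm]
    exact Finset.sum_congr rfl fun j _ => Finset.sum_congr rfl fun i _ => by rw [s j i]; ring
  have t2 : ∑ i, ∑ j, up G (rho G f) x ![i, j, k] * (G x j m * rhoTrace i G f x)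
      = ∑ i, rhoMixed m i k G f x * rhoTrace i G f x := by
    simp only [← rhoMixed_eq h hx, Finset.sum_mul]
    exact Finset.sum_congr rfl fun i _ => Finset.sum_congr rfl fun j _ => by
      rw [s j m, r j i]; ring
  have t3 : ∑ i, ∑ j, up G (rho G f) x ![i, j, k] * (G x i m * rhoTrace j G f x)
      = ∑ i, rhoMixed m i k G f x * rhoTrace i G f x := by
    simp only [← rhoMixed_eq h hx, Finset.sum_mul]
    rw [Finset.sum_comm]
    exact Finset.sum_congr rfl fun j _ => Finset.sum_congr rfl fun i _ => by rw [s i m]; ring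
  have e : ∀ i j, up G (rho G f) x ![i, j, k] * rho G f x ![i, j, m]
      = rhoUp i j k G f x * rhoSym i j m G f x + (1 / 3 : ℝ) *
        (up G (rho G f) x ![i, j, k] * (G x i j * rhoTrace m G f x)
        + up G (rho G f) x ![i, j, k] * (G x j m * rhoTrace i G f x)
        + up G (rho G f) x ![i, j, k] * (G x i m * rhoTrace j G f x)) := fun i j => by
    rw [rho_eq h hx, ← up_rho_eq h hx]; ring
  simp only [e, Finset.sum_add_distrib, ← Finset.mul_sum, t1, t2, t3, rhoSquare]
  ring

theorem isPoly_W : IsPoly W := by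
  refine (IsPoly.sum (s := Finset.univ) fun k => IsPoly.sum (s := Finset.univ) fun m =>
    (isPoly_rhoSquare k m).mul (isPoly_phiMixed k m)).congr fun {U G f} h x hx => ?_
  simp only [W, ← rhoSquare_eq h hx, ← phiMixed_eq h hx]
  generalize up G (rho G f) x = r
  have e : ∀ i j k, ∑ l, r ![i, j, k] * (∑ m, rho G f x ![i, j, m] * ginv G x m l) *
      phi G f x ![k, l] = ∑ m, r ![i, j, k] * rho G f x ![i, j, m] *
        ∑ l, ginv G x m l * phi G f x ![k, l] := fun i j k => by
    simp only [Finset.mul_sum, Finset.sum_mul]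
    rw [Finset.sum_comm]
    exact Finset.sum_congr rfl fun m _ => Finset.sum_congr rfl fun l _ => by ring
  simp only [e]
  generalize (fun m k => ∑ l, ginv G x m l * phi G f x ![k, l]) = p
  simp only [Fin.sum_univ_three]
  ring

end Polynomiality

/-! ### Conformal rescalings of the Euclidean metric -/

/-- A smooth conformal rescaling of the Euclidean metric, together with a smooth function. -/
structure IsRescaling (U : Set Pt) (f Ω : Pt → ℝ) : Prop where
  pair : IsMetricPair (rescale Ω euclid) f U
  smooth : ContDiffOn ℝ ∞ Ω U
  ne_zero : ∀ x ∈ U, Ω x ≠ 0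

/-- The logarithmic derivative `∂_i Ω / Ω`. -/
def logDeriv (Ω : Pt → ℝ) (i : Fin 3) (x : Pt) : ℝ := pd i Ω x * (Ω x)⁻¹

theorem ginv_euclid (x : Pt) (i j : Fin 3) : ginv euclid x i j = if i = j then 1 else 0 := by
  simp [ginv, euclid, Matrix.one_apply]

theorem christoffel_euclid (l i j : Fin 3) (x : Pt) : christoffel euclid l i j x = 0 := by
  simp [christoffel, euclid, pd_const]

theorem up_euclid {k : ℕ} (T : Tensor k) : up euclid T = T := by
  funext x a
  have e : ∀ j : Fin k → Fin 3, ∏ p, ginv euclid x (a p) (j p) = if a = j then 1 else 0 := by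
    intro j
    simp only [ginv_euclid]
    rw [Finset.prod_ite_zero]
    simp [funext_iff]
  simp [up, e]

namespace IsRescaling

variable {U : Set Pt} {f Ω : Pt → ℝ} {x : Pt}

theorem euclid (h : IsRescaling U f Ω) : IsMetricPair euclid f U where
  isOpen := h.pair.isOpen
  smooth _ _ := contDiffOn_const
  posDef _ _ := Matrix.PosDef.one
  smooth_fun := h.pair.smooth_fun

theorem ginv_rescale (h : IsRescaling U f Ω) (hx : x ∈ U) (i j : Fin 3) :
    ginv (rescale Ω ConfInv.euclid) x i j = (Ω x)⁻¹ ^ 2 * if i = j then 1 else 0 := by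
  have e : (rescale Ω ConfInv.euclid x)⁻¹ = ((Ω x)⁻¹ ^ 2) • (1 : Matrix (Fin 3) (Fin 3) ℝ) := by
    apply Matrix.inv_eq_left_inv
    have := h.ne_zero x hx
    simp [rescale, ConfInv.euclid, smul_smul, this]
  simp [ginv, e, Matrix.one_apply]

theorem up_rescale (h : IsRescaling U f Ω) (hx : x ∈ U) {k : ℕ} (T : Tensor k)
    (a : Fin k → Fin 3) :
    up (rescale Ω ConfInv.euclid) T x a = ((Ω x)⁻¹ ^ 2) ^ k * T x a := by
  have e : ∀ j : Fin k → Fin 3, ∏ p, ginv (rescale Ω ConfInv.euclid) x (a p) (j p)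
      = ((Ω x)⁻¹ ^ 2) ^ k * if a = j then 1 else 0 := by
    intro j
    simp only [h.ginv_rescale hx, Finset.prod_mul_distrib]
    rw [Finset.prod_ite_zero]
    simp [funext_iff]
  simp [up, e]

theorem differentiableAt (h : IsRescaling U f Ω) (hx : x ∈ U) : DifferentiableAt ℝ Ω x :=
  differentiableAt_of_contDiffOn h.pair.isOpen h.smooth hx

theorem differentiableAt_inv_pow (h : IsRescaling U f Ω) (hx : x ∈ U) (n : ℕ) :
    DifferentiableAt ℝ (fun y => (Ω y)⁻¹ ^ n) x :=
  ((h.differentiableAt hx).inv (h.ne_zero x hx)).pow n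

theorem pd_inv (h : IsRescaling U f Ω) (hx : x ∈ U) (i : Fin 3) :
    pd i (fun y => (Ω y)⁻¹) x = -(Ω x)⁻¹ * logDeriv Ω i x := by
  have d1 := h.differentiableAt hx
  have d2 : DifferentiableAt ℝ (fun y => (Ω y)⁻¹) x := d1.inv (h.ne_zero x hx)
  have e : pd i (fun y => Ω y * (Ω y)⁻¹) x = 0 := by
    rw [pd_congr h.pair.isOpen (fun y hy => mul_inv_cancel₀ (h.ne_zero y hy)) hx, pd_const]
  rw [pd_mul d1 d2] at e
  have := h.ne_zero x hx
  rw [logDeriv]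
  field_simp at e ⊢
  linear_combination e

theorem pd_inv_pow (h : IsRescaling U f Ω) (hx : x ∈ U) (n : ℕ) (i : Fin 3) :
    pd i (fun y => (Ω y)⁻¹ ^ n) x = -(n * (Ω x)⁻¹ ^ n * logDeriv Ω i x) := by
  induction n with
  | zero => simp [pd_const]
  | succ n ih =>
    have d : DifferentiableAt ℝ (fun y => (Ω y)⁻¹) x :=
      (h.differentiableAt hx).inv (h.ne_zero x hx)
    simp only [pow_succ]
    rw [pd_mul (h.differentiableAt_inv_pow hx n) d, ih, h.pd_inv hx]
    push_cast
    ring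

/-- The gradient of a quantity scaling by Ω⁻ⁿ scales likewise up to the correction -n s υ_i, the
only way υ enters through partial derivatives. -/
theorem pd_inv_pow_mul (h : IsRescaling U f Ω) (hx : x ∈ U) {s t : Pt → ℝ} {n : ℕ}
    (hs : DifferentiableAt ℝ s x) (ht : ∀ y ∈ U, t y = (Ω y)⁻¹ ^ n * s y) (i : Fin 3) :
    pd i t x = (Ω x)⁻¹ ^ n * (pd i s x - n * s x * logDeriv Ω i x) := by
  rw [pd_congr h.pair.isOpen ht hx, pd_mul (h.differentiableAt_inv_pow hx n) hs,
    h.pd_inv_pow hx]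
  ring

theorem christoffel_rescale (h : IsRescaling U f Ω) (hx : x ∈ U) (l i j : Fin 3) :
    christoffel (rescale Ω ConfInv.euclid) l i j x =
      (if l = i then logDeriv Ω j x else 0) + (if l = j then logDeriv Ω i x else 0)
        - if i = j then logDeriv Ω l x else 0 := by
  have d1 := h.differentiableAt hx
  have e : ∀ c a b, pd c (fun y => rescale Ω ConfInv.euclid y a b) x
      = if a = b then 2 * Ω x * pd c Ω x else 0 := by
    intro c a b
    by_cases hab : a = b
    · simp only [rescale, ConfInv.euclid, Matrix.smul_apply, Matrix.one_apply, hab, if_true,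
        smul_eq_mul, mul_one, sq]
      rw [pd_mul d1 d1]
      ring
    · simp [rescale, ConfInv.euclid, hab, pd_const]
  have h0 := h.ne_zero x hx
  simp only [christoffel, h.ginv_rescale hx, e, logDeriv, mul_assoc, ite_mul, one_mul, zero_mul,
    mul_ite, mul_zero, Finset.sum_ite_eq, Finset.mem_univ, if_true]
  rw [if_congr (eq_comm (a := j) (b := l)) rfl rfl, if_congr (eq_comm (a := i) (b := l)) rfl rfl]
  split_ifs <;> field_simp <;> ring

/-! #### Second order -/

theorem jet₁_rescale (i : Fin 3) :
    covD (rescale Ω ConfInv.euclid) f 1 x ![i] = covD ConfInv.euclid f 1 x ![i] := by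
  have e := fun G => congrFun (jet₁_eq i G f) x
  simp only [jet₁] at e
  rw [e, e]

theorem jet₂_euclid (i j : Fin 3) : covD ConfInv.euclid f 2 x ![i, j] = pd i (pd j f) x := by
  have e := congrFun (congrFun (congrFun (congrFun (congrFun jet₂_eq i) j) ConfInv.euclid) f) x
  simp only [jet₂, cov₁, christoffel_euclid, jet₁_eq] at e
  simpa using e

theorem jet₂_symm (h : IsRescaling U f Ω) (hx : x ∈ U) (i j : Fin 3) :
    covD ConfInv.euclid f 2 x ![i, j] = covD ConfInv.euclid f 2 x ![j, i] := by
  rw [jet₂_euclid, jet₂_euclid, pd_comm h.pair.isOpen h.pair.smooth_fun hx]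

/-- `f_i ∂_i Ω / Ω`. -/
def logDerivDot (f Ω : Pt → ℝ) (x : Pt) : ℝ :=
  ∑ m, logDeriv Ω m x * covD ConfInv.euclid f 1 x ![m]

theorem jet₂_rescale (h : IsRescaling U f Ω) (hx : x ∈ U) (i j : Fin 3) :
    covD (rescale Ω ConfInv.euclid) f 2 x ![i, j] = covD ConfInv.euclid f 2 x ![i, j]
      - logDeriv Ω i x * covD ConfInv.euclid f 1 x ![j]
      - logDeriv Ω j x * covD ConfInv.euclid f 1 x ![i]
      + if i = j then logDerivDot f Ω x else 0 := by
  have e := congrFun (congrFun (congrFun (congrFun (congrFun jet₂_eq i) j)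
    (rescale Ω ConfInv.euclid)) f) x
  simp only [jet₂, cov₁, h.christoffel_rescale hx, jet₁_eq] at e
  have e1 := fun G i => congrFun (jet₁_eq i G f) x
  simp only [jet₁] at e1
  simp only [e, jet₂_euclid, logDerivDot, e1, sub_mul, add_mul, ite_mul, zero_mul,
    Finset.sum_sub_distrib, Finset.sum_add_distrib, Finset.sum_ite_eq', Finset.mem_univ, if_true]
  split_ifs
  · ring
  · simp; ring

theorem J_rescale (h : IsRescaling U f Ω) (hx : x ∈ U) :
    J (rescale Ω ConfInv.euclid) f x = (Ω x)⁻¹ ^ 2 * J ConfInv.euclid f x := by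
  simp only [J, h.up_rescale hx, up_euclid, jet₁_rescale, Finset.mul_sum]
  exact Finset.sum_congr rfl fun _ _ => by ring

theorem lap_rescale (h : IsRescaling U f Ω) (hx : x ∈ U) :
    lap (rescale Ω ConfInv.euclid) f x =
      (Ω x)⁻¹ ^ 2 * (lap ConfInv.euclid f x + logDerivDot f Ω x) := by
  simp [lap, h.ginv_rescale hx, ginv_euclid, h.jet₂_rescale hx, Fin.sum_univ_three, logDerivDot]
  ring

/-- Contracting the change of f_{ik} with f^k, the two terms f_i (υ·f) cancel and only -Jυ_i
remains. -/
theorem hessGrad_rescale (h : IsRescaling U f Ω) (hx : x ∈ U) (i : Fin 3) :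
    hessGrad (rescale Ω ConfInv.euclid) f x i = (Ω x)⁻¹ ^ 2 *
      (hessGrad ConfInv.euclid f x i - J ConfInv.euclid f x * logDeriv Ω i x) := by
  simp only [hessGrad, J, h.up_rescale hx, up_euclid, jet₁_rescale, h.jet₂_rescale hx,
    logDerivDot, Fin.sum_univ_three]
  fin_cases i <;> simp <;> ring

theorem hessGradGrad_rescale (h : IsRescaling U f Ω) (hx : x ∈ U) :
    hessGradGrad (rescale Ω ConfInv.euclid) f x = (Ω x)⁻¹ ^ 4 *
      (hessGradGrad ConfInv.euclid f x - J ConfInv.euclid f x * logDerivDot f Ω x) := by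
  simp [hessGradGrad, J, h.up_rescale hx, up_euclid, jet₁_rescale, h.jet₂_rescale hx,
    logDerivDot, Fin.sum_univ_three]
  ring

/-- The shifts -J(υ·f) of f^{ij}f_if_j and +J(υ·f) of J f^j_j cancel. -/
theorem Z_rescale (h : IsRescaling U f Ω) (hx : x ∈ U) :
    Z (rescale Ω ConfInv.euclid) f x = (Ω x)⁻¹ ^ 4 * Z ConfInv.euclid f x := by
  simp only [Z, h.hessGradGrad_rescale hx, h.J_rescale hx, h.lap_rescale hx]
  ring

/-- Put s = υ·f, h_i = f_i^k f_k, L = f^j_j. Apart from the factor Ω⁻⁶, the three terms of X change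
by -4J h·υ + 2J²|υ|², by 4J h·υ - 2JLs - 2J²|υ|² - Js², and by 2JLs + Js², with sum zero. -/
theorem X_rescale (h : IsRescaling U f Ω) (hx : x ∈ U) :
    X (rescale Ω ConfInv.euclid) f x = (Ω x)⁻¹ ^ 6 * X ConfInv.euclid f x := by
  have s := h.jet₂_symm hx
  have hl : lap ConfInv.euclid f x = ∑ i, covD ConfInv.euclid f 2 x ![i, i] := by
    simp [lap, ginv_euclid]
  simp only [X, h.J_rescale hx, h.lap_rescale hx, h.hessGrad_rescale hx, hl]
  simp only [J, hessGrad, h.up_rescale hx, up_euclid, jet₁_rescale, h.jet₂_rescale hx,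
    logDerivDot, Fin.sum_univ_three, s 1 0, s 2 0, s 2 1]
  simp
  ring

/-- The change -J(υ_i f_j + υ_j f_i) of J f_{ij} is cancelled by h_i ↦ h_i - Jυ_i for h_i = f_i^k
f_k; the multiples of g cancel because 1 - 1/3 - 2/3 = 0. -/
theorem phi_rescale (h : IsRescaling U f Ω) (hx : x ∈ U) (i j : Fin 3) :
    phi (rescale Ω ConfInv.euclid) f x ![i, j] = (Ω x)⁻¹ ^ 2 * phi ConfInv.euclid f x ![i, j] := by
  have e := fun G => congrFun (congrFun (congrFun (phi₂_eq i j) G) f) x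
  simp only [phi₂] at e
  have h0 := h.ne_zero x hx
  simp only [e, phiCore, phiTrace, jet₁, jet₂, h.hessGradGrad_rescale hx, h.J_rescale hx,
    h.lap_rescale hx, jet₁_rescale, h.jet₂_rescale hx, h.hessGrad_rescale hx]
  simp only [rescale, ConfInv.euclid, Matrix.smul_apply, Matrix.one_apply, smul_eq_mul]
  split_ifs <;> field_simp <;> ring

theorem phi_symm (h : IsRescaling U f Ω) (hx : x ∈ U) (i j : Fin 3) :
    phi ConfInv.euclid f x ![i, j] = phi ConfInv.euclid f x ![j, i] := by
  have e := fun i j => congrFun (congrFun (congrFun (phi₂_eq i j) ConfInv.euclid) f) x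
  simp only [phi₂] at e
  rw [e, e, phiCore, phiCore, jet₂, jet₂, h.jet₂_symm hx i j, h.euclid.symm hx i j]
  ring

theorem phi_trace : ∑ l, phi ConfInv.euclid f x ![l, l] = 0 := by
  have e := fun i j => congrFun (congrFun (congrFun (phi₂_eq i j) ConfInv.euclid) f) x
  simp only [phi₂] at e
  simp only [e, phiCore, phiTrace, jet₁, jet₂, hessGradGrad, J, hessGrad, lap, up_euclid,
    ginv_euclid, Fin.sum_univ_three]
  simp [ConfInv.euclid]
  ring

/-! #### Third order -/

/-- The corrections -4υ_i and -2υ_i from ∇Z and ∇J cancel in J∇Z - 2Z∇J. -/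
theorem sigma_rescale (h : IsRescaling U f Ω) (hx : x ∈ U) (i : Fin 3) :
    sigma (rescale Ω ConfInv.euclid) f x ![i]
      = (Ω x)⁻¹ ^ 6 * sigma ConfInv.euclid f x ![i] := by
  have hJ := h.pd_inv_pow_mul hx (isTensor₀_J.smooth.differentiableAt h.euclid hx)
    (fun y hy => h.J_rescale hy) i
  have hZ := h.pd_inv_pow_mul hx (isTensor₀_Z.smooth.differentiableAt h.euclid hx)
    (fun y hy => h.Z_rescale hy) i
  simp only [sigma, grad, Matrix.cons_val_zero, hJ, hZ, h.J_rescale hx, h.Z_rescale hx]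
  push_cast
  ring

theorem tau_rescale (h : IsRescaling U f Ω) (hx : x ∈ U) (i : Fin 3) :
    tau (rescale Ω ConfInv.euclid) f x ![i]
      = (Ω x)⁻¹ ^ 8 * tau ConfInv.euclid f x ![i] := by
  have hJ := h.pd_inv_pow_mul hx (isTensor₀_J.smooth.differentiableAt h.euclid hx)
    (fun y hy => h.J_rescale hy) i
  have hX := h.pd_inv_pow_mul hx (isTensor₀_X.smooth.differentiableAt h.euclid hx)
    (fun y hy => h.X_rescale hy) i
  simp only [tau, grad, Matrix.cons_val_zero, hJ, hX, h.J_rescale hx, h.X_rescale hx]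
  push_cast
  ring

/-- `φ_{ij} ∂_j Ω / Ω`. -/
def phiLogDeriv (f Ω : Pt → ℝ) (i : Fin 3) (x : Pt) : ℝ :=
  ∑ m, phi ConfInv.euclid f x ![i, m] * logDeriv Ω m x

theorem nabla_phi_euclid (c i j : Fin 3) :
    nabla ConfInv.euclid (phi ConfInv.euclid f) x ![c, i, j]
      = pd c (fun y => phi ConfInv.euclid f y ![i, j]) x := by
  simp [nabla_two, christoffel_euclid]

/-- The coefficient -4 of υ_c φ_{ij} is -2 from the weight of φ and -1 from each of the two
Christoffel corrections. -/
theorem nabla_phi_rescale (h : IsRescaling U f Ω) (hx : x ∈ U) (c i j : Fin 3) :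
    nabla (rescale Ω ConfInv.euclid) (phi (rescale Ω ConfInv.euclid) f) x ![c, i, j]
      = (Ω x)⁻¹ ^ 2 * (nabla ConfInv.euclid (phi ConfInv.euclid f) x ![c, i, j]
        - 4 * logDeriv Ω c x * phi ConfInv.euclid f x ![i, j]
        - logDeriv Ω i x * phi ConfInv.euclid f x ![c, j]
        - logDeriv Ω j x * phi ConfInv.euclid f x ![c, i]
        + (if c = i then phiLogDeriv f Ω j x else 0)
        + (if c = j then phiLogDeriv f Ω i x else 0)) := by
  have hd := h.pd_inv_pow_mul hx ((isSmooth_phi₂ i j).differentiableAt h.euclid hx)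
    (fun y hy => h.phi_rescale hy i j) c
  rw [nabla_two, hd, nabla_phi_euclid,
    show (fun y => phi ConfInv.euclid f y ![i, j]) = phi₂ i j ConfInv.euclid f from rfl]
  simp only [phi₂, h.christoffel_rescale hx, h.phi_rescale hx, phiLogDeriv, sub_mul, add_mul,
    ite_mul, zero_mul, Finset.sum_sub_distrib, Finset.sum_add_distrib, Finset.sum_ite_eq',
    Finset.mem_univ, if_true]
  have s := h.phi_symm hx
  simp only [Fin.sum_univ_three, s i c, s 0 j, s 1 j, s 2 j]
  split_ifs <;> push_cast <;> ring

/-- In dimension three the contraction collects -4 - 1 + 1 + 3 = -1 times φ_{kl}υ_l, the term in υ_k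
dropping out because φ is trace-free. -/
theorem divPhi_rescale (h : IsRescaling U f Ω) (hx : x ∈ U) (k : Fin 3) :
    divPhi (rescale Ω ConfInv.euclid) f x k = (Ω x)⁻¹ ^ 4 *
      (divPhi ConfInv.euclid f x k - phiLogDeriv f Ω k x) := by
  have t : ∑ l, phi ConfInv.euclid f x ![l, l] = 0 := phi_trace
  have s := h.phi_symm hx
  simp only [divPhi, h.nabla_phi_rescale hx, h.ginv_rescale hx, ginv_euclid]
  simp only [Fin.sum_univ_three] at t
  have q : phiLogDeriv f Ω k x = ∑ m, phi ConfInv.euclid f x ![k, m] * logDeriv Ω m x := rfl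
  simp only [Fin.sum_univ_three] at q
  simp only [Fin.sum_univ_three, s 0 k, s 1 k, s 2 k]
  have d : (if (0 : Fin 3) = k then phiLogDeriv f Ω 0 x else 0)
      + (if (1 : Fin 3) = k then phiLogDeriv f Ω 1 x else 0)
      + (if (2 : Fin 3) = k then phiLogDeriv f Ω 2 x else 0) = phiLogDeriv f Ω k x := by
    fin_cases k <;> simp
  simp
  linear_combination (Ω x)⁻¹ ^ 4 * (d - logDeriv Ω k x * t + 5 * q)

theorem phiGradJ_rescale (h : IsRescaling U f Ω) (hx : x ∈ U) (k : Fin 3) :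
    phiGradJ (rescale Ω ConfInv.euclid) f x k = (Ω x)⁻¹ ^ 6 *
      (phiGradJ ConfInv.euclid f x k - 2 * J ConfInv.euclid f x * phiLogDeriv f Ω k x) := by
  have hJ := h.pd_inv_pow_mul hx (isTensor₀_J.smooth.differentiableAt h.euclid hx)
    (fun y hy => h.J_rescale hy)
  simp only [phiGradJ, h.up_rescale hx, up_euclid, grad, Matrix.cons_val_zero, hJ,
    h.phi_rescale hx, phiLogDeriv, Fin.sum_univ_three]
  push_cast
  ring

theorem lam_rescale (h : IsRescaling U f Ω) (hx : x ∈ U) (i : Fin 3) :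
    lam (rescale Ω ConfInv.euclid) f x ![i] = (Ω x)⁻¹ ^ 6 * lam ConfInv.euclid f x ![i] := by
  simp only [lam, h.J_rescale hx, h.divPhi_rescale hx, h.phiGradJ_rescale hx]
  ring

theorem rho_rescale (h : IsRescaling U f Ω) (hx : x ∈ U) (i j k : Fin 3) :
    rho (rescale Ω ConfInv.euclid) f x ![i, j, k]
      = (Ω x)⁻¹ ^ 4 * rho ConfInv.euclid f x ![i, j, k] := by
  have hJ := h.pd_inv_pow_mul hx (isTensor₀_J.smooth.differentiableAt h.euclid hx)
    (fun y hy => h.J_rescale hy)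
  have hg : ∀ a b, (Ω x)⁻¹ ^ 2 * rescale Ω ConfInv.euclid x a b = ConfInv.euclid x a b := by
    intro a b
    have h0 := h.ne_zero x hx
    simp only [rescale, Matrix.smul_apply, smul_eq_mul]
    field_simp
  have hif : ∀ (a b : Fin 3) (u : ℝ), (if a = b then u else 0) = ConfInv.euclid x a b * u := by
    intro a b u
    simp [ConfInv.euclid, Matrix.one_apply]
  -- Before symmetrisation the expression is not covariant; the defect is recorded explicitly. Its
  -- last line is 2/5 - 12/5 = -2, from the two trace terms.
  have term : ∀ a b c,
      J (rescale Ω ConfInv.euclid) f x *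
        nabla (rescale Ω ConfInv.euclid) (phi (rescale Ω ConfInv.euclid) f) x ![a, b, c]
      - 3 * phi (rescale Ω ConfInv.euclid) f x ![a, b] *
        grad (J (rescale Ω ConfInv.euclid) f) x ![c]
      - (2 / 5) * J (rescale Ω ConfInv.euclid) f x * rescale Ω ConfInv.euclid x a b *
        divPhi (rescale Ω ConfInv.euclid) f x c
      + (6 / 5) * rescale Ω ConfInv.euclid x a b * phiGradJ (rescale Ω ConfInv.euclid) f x c
      = (Ω x)⁻¹ ^ 4 * (J ConfInv.euclid f x *
          nabla ConfInv.euclid (phi ConfInv.euclid f) x ![a, b, c]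
        - 3 * phi ConfInv.euclid f x ![a, b] * grad (J ConfInv.euclid f) x ![c]
        - (2 / 5) * J ConfInv.euclid f x * ConfInv.euclid x a b * divPhi ConfInv.euclid f x c
        + (6 / 5) * ConfInv.euclid x a b * phiGradJ ConfInv.euclid f x c
        + J ConfInv.euclid f x * (-4 * logDeriv Ω a x * phi ConfInv.euclid f x ![b, c]
          - logDeriv Ω b x * phi ConfInv.euclid f x ![a, c]
          - logDeriv Ω c x * phi ConfInv.euclid f x ![a, b]
          + ConfInv.euclid x a b * phiLogDeriv f Ω c x
          + ConfInv.euclid x a c * phiLogDeriv f Ω b x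
          + 6 * logDeriv Ω c x * phi ConfInv.euclid f x ![a, b]
          - 2 * ConfInv.euclid x a b * phiLogDeriv f Ω c x)) := by
    intro a b c
    simp only [h.J_rescale hx, h.nabla_phi_rescale hx, h.phi_rescale hx, grad,
      Matrix.cons_val_zero, hJ, h.divPhi_rescale hx, h.phiGradJ_rescale hx, hif, ← hg a b]
    push_cast
    ring
  have s := h.phi_symm hx
  have g := h.euclid.symm hx
  have cv : ∀ a b c : Fin 3, (![a, b, c] : Fin 3 → Fin 3) 2 = c := fun _ _ _ => rfl
  simp only [rho, sym_three, Matrix.cons_val_zero, Matrix.cons_val_one, cv, term]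
  -- After symmetrisation the defect vanishes: -4 - 1 - 1 + 6 = 0 for the terms υφ, and 1 + 1 - 2 =
  -- 0 for the terms with the metric.
  rw [s j i, s k i, s k j, g j i, g k i, g k j]
  ring

end IsRescaling

/-! ### Weights -/

/-- The quantity scales by `Ω^{-n}` under conformal rescalings of the Euclidean metric. -/
def HasWeight (q : Quantity) (n : ℕ) : Prop :=
  ∀ ⦃U : Set Pt⦄ ⦃f Ω : Pt → ℝ⦄, IsRescaling U f Ω → ∀ x ∈ U,
    q (rescale Ω euclid) f x = (Ω x)⁻¹ ^ n * q euclid f x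

/-- The covector scales by `Ω^{-n}` under conformal rescalings of the Euclidean metric. -/
def HasWeight₁ (w : MetricField → (Pt → ℝ) → Tensor 1) (n : ℕ) : Prop :=
  ∀ ⦃U : Set Pt⦄ ⦃f Ω : Pt → ℝ⦄, IsRescaling U f Ω → ∀ x ∈ U, ∀ i,
    w (rescale Ω euclid) f x ![i] = (Ω x)⁻¹ ^ n * w euclid f x ![i]

theorem HasWeight₁.pair {v w : MetricField → (Pt → ℝ) → Tensor 1} {m n : ℕ}
    (hv : HasWeight₁ v m) (hw : HasWeight₁ w n) :
    HasWeight (fun G f => pair G (v G f) (w G f)) (2 + m + n) := by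
  intro U f Ω h x hx
  simp only [ConfInv.pair, h.up_rescale hx, up_euclid, hv h x hx, hw h x hx, Finset.mul_sum]
  exact Finset.sum_congr rfl fun _ _ => by ring

/-- The 6 is 2 for φ_{ij} and 2 for each of its raised indices. -/
theorem HasWeight₁.phiPair {v w : MetricField → (Pt → ℝ) → Tensor 1} {m n : ℕ}
    (hv : HasWeight₁ v m) (hw : HasWeight₁ w n) :
    HasWeight (fun G f => phiPair G f (v G f) (w G f)) (6 + m + n) := by
  intro U f Ω h x hx
  simp only [ConfInv.phiPair, h.up_rescale hx, up_euclid, hv h x hx, hw h x hx,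
    h.phi_rescale hx, Finset.mul_sum]
  exact Finset.sum_congr rfl fun _ _ => Finset.sum_congr rfl fun _ _ => by ring

theorem hasWeight₁_jet : HasWeight₁ (fun G f => covD G f 1) 0 := fun _ _ _ _ _ _ i => by
  simp only [IsRescaling.jet₁_rescale, pow_zero, one_mul]

theorem hasWeight₁_sigma : HasWeight₁ sigma 6 := fun _ _ _ h _ hx i => h.sigma_rescale hx i

theorem hasWeight₁_tau : HasWeight₁ tau 8 := fun _ _ _ h _ hx i => h.tau_rescale hx i

theorem hasWeight₁_lam : HasWeight₁ lam 6 := fun _ _ _ h _ hx i => h.lam_rescale hx i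

theorem hasWeight_F : HasWeight F 18 := by
  intro U f Ω h x hx
  simp only [F, h.up_rescale hx, up_euclid, h.phi_rescale hx, h.rho_rescale hx,
    h.lam_rescale hx, Finset.mul_sum]
  exact Finset.sum_congr rfl fun _ _ => Finset.sum_congr rfl fun _ _ =>
    Finset.sum_congr rfl fun _ _ => by ring

theorem hasWeight_N : HasWeight N 18 := by
  intro U f Ω h x hx
  simp only [N, h.up_rescale hx, up_euclid, h.phi_rescale hx, h.rho_rescale hx,
    h.sigma_rescale hx, Finset.mul_sum]
  exact Finset.sum_congr rfl fun _ _ => Finset.sum_congr rfl fun _ _ =>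
    Finset.sum_congr rfl fun _ _ => by ring

theorem hasWeight_W : HasWeight W 18 := by
  intro U f Ω h x hx
  simp only [W, h.up_rescale hx, up_euclid, h.phi_rescale hx, h.rho_rescale hx,
    h.ginv_rescale hx, ginv_euclid, mul_ite, mul_one, mul_zero, Finset.sum_ite_eq',
    Finset.mem_univ, if_true, Finset.mul_sum]
  exact Finset.sum_congr rfl fun _ _ => Finset.sum_congr rfl fun _ _ =>
    Finset.sum_congr rfl fun _ _ => Finset.sum_congr rfl fun _ _ => by ring

/-- A natural quantity given by a polynomial in the jet and scaling by a power of `Ω` is a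
conformal differential invariant. -/
theorem isConformalInvariant {q : Quantity} {n : ℕ} (hp : IsPoly q) (hn : IsNatural q)
    (hw : HasWeight q n) : IsConformalInvariant q (-(n : ℤ)) := by
  obtain ⟨P, hP⟩ := hp
  refine ⟨P, fun U G f hU hG hf x hx => hP (hG.isMetricPair hU hf) x hx, ?_, ?_⟩
  · intro U V G f Φ hU hV hG hf hΦ hm hd x hx
    have h : IsCoordChange U V G f Φ := ⟨hG.isMetricPair hU hf, hV, hΦ, hm, hd⟩
    rw [← hP h.isMetricPair x hx, ← hP h.pair _ (hm hx), hn h x hx]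
  · intro U f Ω hU hf hΩ h0 hG x hx
    have h : IsRescaling U f Ω := ⟨hG.isMetricPair hU hf, hΩ, h0⟩
    rw [← hP h.pair x hx, ← hP h.euclid x hx, hw h x hx, zpow_neg, zpow_natCast, inv_pow]

/-! ### The sixteen invariants -/

theorem isConformalInvariant_J : IsConformalInvariant J (-2) :=
  isConformalInvariant isTensor₀_J.poly isTensor₀_J.natural fun _ _ _ h _ hx => h.J_rescale hx

theorem isConformalInvariant_Z : IsConformalInvariant Z (-4) :=
  isConformalInvariant isTensor₀_Z.poly isTensor₀_Z.natural fun _ _ _ h _ hx => h.Z_rescale hx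

theorem isConformalInvariant_X : IsConformalInvariant X (-6) :=
  isConformalInvariant isTensor₀_X.poly isTensor₀_X.natural fun _ _ _ h _ hx => h.X_rescale hx

theorem isConformalInvariant_R : IsConformalInvariant R (-8) :=
  isConformalInvariant (.pair isTensor₁_jet₁.poly isPoly_sigma)
    (isTensor₁_jet₁.natural.pair isNatural₁_sigma) (hasWeight₁_jet.pair hasWeight₁_sigma)

theorem isConformalInvariant_S : IsConformalInvariant S (-10) :=
  isConformalInvariant (.pair isTensor₁_jet₁.poly isPoly_tau)
    (isTensor₁_jet₁.natural.pair isNatural₁_tau) (hasWeight₁_jet.pair hasWeight₁_tau)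

theorem isConformalInvariant_A : IsConformalInvariant A (-14) :=
  isConformalInvariant (.pair isPoly_sigma isPoly_sigma)
    (isNatural₁_sigma.pair isNatural₁_sigma) (hasWeight₁_sigma.pair hasWeight₁_sigma)

theorem isConformalInvariant_B : IsConformalInvariant B (-18) :=
  isConformalInvariant (.pair isPoly_tau isPoly_tau)
    (isNatural₁_tau.pair isNatural₁_tau) (hasWeight₁_tau.pair hasWeight₁_tau)

theorem isConformalInvariant_D : IsConformalInvariant D (-16) :=
  isConformalInvariant (.pair isPoly_sigma isPoly_tau)
    (isNatural₁_sigma.pair isNatural₁_tau) (hasWeight₁_sigma.pair hasWeight₁_tau)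

theorem isConformalInvariant_T : IsConformalInvariant T (-18) :=
  isConformalInvariant (.phiPair isPoly_sigma isPoly_sigma)
    (isNatural₁_sigma.phiPair isNatural₁_sigma) (hasWeight₁_sigma.phiPair hasWeight₁_sigma)

theorem isConformalInvariant_U : IsConformalInvariant U (-22) :=
  isConformalInvariant (.phiPair isPoly_tau isPoly_tau)
    (isNatural₁_tau.phiPair isNatural₁_tau) (hasWeight₁_tau.phiPair hasWeight₁_tau)

theorem isConformalInvariant_F : IsConformalInvariant F (-18) :=
  isConformalInvariant isPoly_F isNatural_F hasWeight_F

theorem isConformalInvariant_GG : IsConformalInvariant GG (-18) :=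
  isConformalInvariant (.phiPair isPoly_lam isPoly_lam)
    (isNatural₁_lam.phiPair isNatural₁_lam) (hasWeight₁_lam.phiPair hasWeight₁_lam)

theorem isConformalInvariant_K : IsConformalInvariant K (-14) :=
  isConformalInvariant (.pair isPoly_sigma isPoly_lam)
    (isNatural₁_sigma.pair isNatural₁_lam) (hasWeight₁_sigma.pair hasWeight₁_lam)

theorem isConformalInvariant_M : IsConformalInvariant M (-16) :=
  isConformalInvariant (.pair isPoly_tau isPoly_lam)
    (isNatural₁_tau.pair isNatural₁_lam) (hasWeight₁_tau.pair hasWeight₁_lam)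

theorem isConformalInvariant_N : IsConformalInvariant N (-18) :=
  isConformalInvariant isPoly_N isNatural_N hasWeight_N

theorem isConformalInvariant_W : IsConformalInvariant W (-18) :=
  isConformalInvariant isPoly_W isNatural_W hasWeight_W

end ConfInv

end

theorem mainTheorem11 :
    ConfInv.IsConformalInvariant ConfInv.J (-2) ∧
    ConfInv.IsConformalInvariant ConfInv.Z (-4) ∧
    ConfInv.IsConformalInvariant ConfInv.X (-6) ∧
    ConfInv.IsConformalInvariant ConfInv.R (-8) ∧
    ConfInv.IsConformalInvariant ConfInv.S (-10) ∧
    ConfInv.IsConformalInvariant ConfInv.A (-14) ∧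
    ConfInv.IsConformalInvariant ConfInv.B (-18) ∧
    ConfInv.IsConformalInvariant ConfInv.D (-16) ∧
    ConfInv.IsConformalInvariant ConfInv.T (-18) ∧
    ConfInv.IsConformalInvariant ConfInv.U (-22) ∧
    ConfInv.IsConformalInvariant ConfInv.F (-18) ∧
    ConfInv.IsConformalInvariant ConfInv.GG (-18) ∧
    ConfInv.IsConformalInvariant ConfInv.K (-14) ∧
    ConfInv.IsConformalInvariant ConfInv.M (-16) ∧
    ConfInv.IsConformalInvariant ConfInv.N (-18) ∧
    ConfInv.IsConformalInvariant ConfInv.W (-18) := by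
  exact ⟨ConfInv.isConformalInvariant_J,
    ConfInv.isConformalInvariant_Z,
    ConfInv.isConformalInvariant_X,
    ConfInv.isConformalInvariant_R,
    ConfInv.isConformalInvariant_S,
    ConfInv.isConformalInvariant_A,
    ConfInv.isConformalInvariant_B,
    ConfInv.isConformalInvariant_D,
    ConfInv.isConformalInvariant_T,
    ConfInv.isConformalInvariant_U,
    ConfInv.isConformalInvariant_F,
    ConfInv.isConformalInvariant_GG,
    ConfInv.isConformalInvariant_K,
    ConfInv.isConformalInvariant_M,
    ConfInv.isConformalInvariant_N,
    ConfInv.isConformalInvariant_W⟩
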